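/- Identify $\mathbb{C}^2$ with $\mathbb{R}^4$, with its standard inner product $\langle\cdot,\cdot\rangle$ and complex structure $J$. Let $M^2$ be a smooth $2$-dimensional manifold without boundary (not necessarily compact or complete) and let $x:M^2\to\mathbb{C}^2$ be a smooth immersion that is - Lagrangian: $\langle J\,dx(v),dx(w)\rangle=0$ for all $p\in M^2$ and $v,w\in T_pM^2$; - a self-shrinker: $\mathbf{H}=-x^{\perp}$, where $\mathbf{H}$ is the mean curvature vector (the trace of the second fundamental form with respect to the induced metric) and $\perp$ denotes the orthogonal projection onto the normal space; - flat: the curvature tensor of the induced metric (equivalently, its Gauss curvature) vanishes identically. An Abresch–Langer curve is a complete immersed curve in $\mathbb{C}=\mathbb{R}^2$ satisfying the self-shrinker equation, that is, parametrized by arc length, a smooth map $\gamma:\mathbb{R}\to\mathbb{C}$ with $|\gamma'|=1$ and $\gamma''=-\gamma^{\perp}=-(\gamma-\langle\gamma,\gamma'\rangle\gamma')$; straight lines through the origin are included. Then $M^2$ is, up to a unitary transformation of $\mathbb{C}^2$, locally an open part of the Riemannian product of two Abresch–Langer curves. Precisely: for every $p\in M^2$ there are Abresch–Langer curves $\gamma_1,\gamma_2:\mathbb{R}\to\mathbb{C}$,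 a unitary map $T:\mathbb{C}^2\to\mathbb{C}^2$, and smooth local coordinates $\varphi=(s,t)$ on an open neighbourhood $U$ of $p$ (a diffeomorphism of $U$ onto an open subset of $\mathbb{R}^2$) such that $$x(q)=T\bigl(\gamma_1(s(q)),\gamma_2(t(q))\bigr)\qquad\text{for all }q\in U .$$ (In particular the induced metric on $U$ is $ds^2+dt^2$.) -/

import Mathlib

open scoped Manifold ContDiff

/-- Euclidean space `ℝⁿ`, the model space of `n`-dimensional manifolds. -/
abbrev RSpace (n : ℕ) : Type := EuclideanSpace ℝ (Fin n)

/-- The complex Euclidean plane `ℂ²`. As a real inner product space it carries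
`⟪v, w⟫ = Re (∑ conj (v i) * w i)`. -/
abbrev C2 : Type := EuclideanSpace ℂ (Fin 2)

namespace Immersed

noncomputable section

section LocalParametrization

/- Geometry of a submanifold of a Euclidean space `F` in a local parametrization
`f`, defined on an open subset of `ℝⁿ`. -/

variable {n : ℕ} {F : Type*} [NormedAddCommGroup F]

/-- The partial derivative `∂ᵢ f`. -/
def partialD [NormedSpace ℝ F] (i : Fin n) (f : RSpace n → F) (u : RSpace n) : F :=
  fderiv ℝ f u (EuclideanSpace.single i (1 : ℝ))

variable [InnerProductSpace ℝ F]

/-- The induced metric `g i j = ⟪∂ᵢ f, ∂ⱼ f⟫`. -/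
def metric (f : RSpace n → F) (u : RSpace n) : Matrix (Fin n) (Fin n) ℝ :=
  Matrix.of fun i j => inner ℝ (partialD i f u) (partialD j f u)

/-- The Christoffel symbols of the Levi-Civita connection of the induced metric,
`Γ k i j = ½ ∑ₗ gᵏˡ (∂ᵢ gⱼₗ + ∂ⱼ gᵢₗ - ∂ₗ gᵢⱼ)`. -/
def christoffel (f : RSpace n → F) (k i j : Fin n) (u : RSpace n) : ℝ :=
  (1 / 2 : ℝ) * ∑ l, (metric f u)⁻¹ k l *
    (partialD i (fun v => metric f v j l) u + partialD j (fun v => metric f v i l) u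
      - partialD l (fun v => metric f v i j) u)

/-- The components of the Riemann curvature tensor of the induced metric,
`R(∂ᵢ, ∂ⱼ) ∂ₖ = ∑ₗ (riemann f l k i j) ∂ₗ`. -/
def riemann (f : RSpace n → F) (l k i j : Fin n) (u : RSpace n) : ℝ :=
  partialD i (christoffel f l j k) u - partialD j (christoffel f l i k) u
    + ∑ m, (christoffel f l i m u * christoffel f m j k u
        - christoffel f l j m u * christoffel f m i k u)

/-- The tangent space of the submanifold at `f u`, a linear subspace of `F`. -/
def tangentPlane (f : RSpace n → F) (u : RSpace n) : Submodule ℝ F :=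
  LinearMap.range (fderiv ℝ f u : RSpace n →ₗ[ℝ] F)

instance (f : RSpace n → F) (u : RSpace n) : FiniteDimensional ℝ (tangentPlane f u) :=
  inferInstanceAs
    (FiniteDimensional ℝ (LinearMap.range (fderiv ℝ f u : RSpace n →ₗ[ℝ] F)))

instance (f : RSpace n → F) (u : RSpace n) : CompleteSpace (tangentPlane f u) :=
  FiniteDimensional.complete ℝ (tangentPlane f u)

/-- The normal part `v^⊥` of a vector `v` at the point `f u`: the orthogonal projection onto the
normal space. -/
def normalPart (f : RSpace n → F) (u : RSpace n) (v : F) : F :=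
  (tangentPlane f u)ᗮ.starProjection v

/-- The second fundamental form `h(∂ᵢ, ∂ⱼ) = (∂ᵢ ∂ⱼ f)^⊥`. -/
def secondFF (f : RSpace n → F) (i j : Fin n) (u : RSpace n) : F :=
  normalPart f u (partialD i (partialD j f) u)

/-- The mean curvature vector `H`, the trace of the second fundamental form with
respect to the induced metric. -/
def meanCurvature (f : RSpace n → F) (u : RSpace n) : F :=
  ∑ i, ∑ j, (metric f u)⁻¹ i j • secondFF f i j u

end LocalParametrization

section Manifolds

variable {n : ℕ} {F : Type*} [NormedAddCommGroup F] [InnerProductSpace ℝ F]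
  {M : Type*} [TopologicalSpace M] [ChartedSpace (RSpace n) M]

/-- `x : M → F` is a smooth immersion. -/
def IsSmoothImmersion (x : M → F) : Prop :=
  ContMDiff 𝓘(ℝ, RSpace n) 𝓘(ℝ, F) ∞ x ∧
    ∀ p : M, Function.Injective (mfderiv 𝓘(ℝ, RSpace n) 𝓘(ℝ, F) x p)

/-- The self-shrinker equation `H = -x^⊥`, in every chart of `M`. -/
def IsSelfShrinker (x : M → F) : Prop :=
  ∀ e ∈ atlas (RSpace n) M, ∀ u ∈ e.target,
    meanCurvature (x ∘ e.symm) u = -normalPart (x ∘ e.symm) u ((x ∘ e.symm) u)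

/-- The metric on `M` induced by `x` is flat: its Riemann curvature tensor vanishes, in every
chart of `M`. For surfaces this says that the Gauss curvature vanishes. -/
def IsFlat (x : M → F) : Prop :=
  ∀ e ∈ atlas (RSpace n) M, ∀ u ∈ e.target, ∀ l k i j : Fin n, riemann (x ∘ e.symm) l k i j u = 0

end Manifolds

/-- `x : M² → ℂ²` is Lagrangian: multiplication by `i` maps each tangent plane
`dx (T_p M)` into the normal plane. -/
def IsLagrangian {M : Type*} [TopologicalSpace M] [ChartedSpace (RSpace 2) M]
    (x : M → C2) : Prop :=
  ∀ (p : M) (v w : RSpace 2),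
    let dx : RSpace 2 →L[ℝ] C2 := mfderiv 𝓘(ℝ, RSpace 2) 𝓘(ℝ, C2) x p
    inner ℝ (Complex.I • dx v) (dx w) = 0

/-- An Abresch–Langer curve: a complete immersed solution of the self-shrinker equation in the
plane `ℂ = ℝ²`, parametrized by arc length. The curvature vector of `γ` is `γ''`, and `γ^⊥` is
`γ - ⟪γ, γ'⟫ γ'`. Straight lines through the origin are included. -/
structure IsAbreschLangerCurve (γ : ℝ → ℂ) : Prop where
  smooth : ContDiff ℝ ∞ γ
  unitSpeed : ∀ s, ‖deriv γ s‖ = 1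
  shrinker : ∀ s, deriv (deriv γ) s = -(γ s - inner ℝ (γ s) (deriv γ s) • deriv γ s)

end

end Immersed

/-! Flatness gives a local parallel tangent frame, and integrating its dual coframe gives
coordinates in which the immersion F has a unitary frame ∂₀F, ∂₁F (`exists_flat_coordinates`). There
all second derivatives are normal, so they are recorded by C_{jkl} = ⟪i∂ₗF, ∂ⱼ∂ₖF⟫. Both C and its
first derivatives are totally symmetric (Lagrangian condition and Codazzi). With y_k = ⟪∂ₖF, F⟫ and
H_l = C_{00l} + C_{11l}, the differentiated shrinker equation reads ∂ₘH_l = ∑ C_{mlk} y_k.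

Put z = u₀ + iu₁, τ = (C₀₀₀ − 3C₀₁₁) + i(C₁₁₁ − 3C₀₀₁), η = H₀ + iH₁ and w = y₀ + iy₁. The Gauss
equation says |τ| = |η|, and Codazzi says ∂_z̄ τ = conj(∂_z̄ η). Where η ≠ 0, f = τ/η is therefore
unimodular with (∂_z̄ f) η = conj(∂_z̄ η) − f ∂_z̄ η. Since ∂_z̄ η is a real multiple of wη +
conj(wτ) and |f| = 1, the right side vanishes. So f is holomorphic of constant modulus, hence
constant (`partialD_quotient`). A fixed rotation makes f = 1, which means C₀₀₁ = C₀₁₁ = 0, that is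
∂₀∂₁F = 0. If η vanishes at the point, the formula for ∂H and the Gauss identity |C| = |H| give a
Grönwall inequality for |H|², so C vanishes nearby and ∂₀∂₁F = 0 again
(`exists_diagonal_direction`).

Once ∂₀∂₁F = 0, the two variables separate and the components of F in the unitary frame at the base
point are functions of one variable each. Each component is a unit-speed planar shrinker
(`exists_component`), and such a curve extends to all of ℝ because its tangent angle satisfies an
ODE that cannot blow up in finite time. -/

namespace Immersed

/-! ### Partial derivatives and the Poincaré lemma -/

section Calculus

variable {n : ℕ} {F G : Type*} [NormedAddCommGroup F] [NormedSpace ℝ F]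
  [NormedAddCommGroup G] [NormedSpace ℝ G] {B : Set (RSpace n)} {u : RSpace n}

theorem fderiv_apply_eq_sum_partialD (f : RSpace n → F) (u v : RSpace n) :
    fderiv ℝ f u v = ∑ i, v i • partialD i f u := by
  have hv : v = ∑ i, v i • EuclideanSpace.single i (1 : ℝ) := by
    ext j
    simp [Finset.sum_apply, Pi.single_apply]
  conv_lhs => rw [hv]
  simp [partialD]

theorem contDiffOn_partialD {f : RSpace n → F} (hB : IsOpen B) (hf : ContDiffOn ℝ ∞ f B)
    (i : Fin n) : ContDiffOn ℝ ∞ (partialD i f) B :=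
  (hf.fderiv_of_isOpen hB (m := ∞) (by simp)).clm_apply contDiffOn_const

theorem differentiableAt_of_contDiffOn {f : RSpace n → F} (hB : IsOpen B)
    (hf : ContDiffOn ℝ ∞ f B) (hu : u ∈ B) : DifferentiableAt ℝ f u :=
  (hf.contDiffAt (hB.mem_nhds hu)).differentiableAt (by simp)

theorem partialD_comm {f : RSpace n → F} (hB : IsOpen B) (hf : ContDiffOn ℝ ∞ f B) (hu : u ∈ B)
    (i j : Fin n) : partialD i (partialD j f) u = partialD j (partialD i f) u := by
  have h : ∀ k : Fin n, ∀ v, fderiv ℝ (partialD k f) u v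
      = fderiv ℝ (fderiv ℝ f) u v (EuclideanSpace.single k 1) := by
    intro k v
    have hd : DifferentiableAt ℝ (fderiv ℝ f) u :=
      ((hf.fderiv_of_isOpen hB (m := ∞) (by simp)).contDiffAt (hB.mem_nhds hu)).differentiableAt
        (by simp)
    have := (hd.hasFDerivAt.clm_apply
      (hasFDerivAt_const (EuclideanSpace.single k (1 : ℝ)) u)).fderiv
    change fderiv ℝ (fun y => fderiv ℝ f y (EuclideanSpace.single k 1)) u v = _
    rw [this]
    simp
  have hs : IsSymmSndFDerivAt ℝ f u :=
    (hf.contDiffAt (hB.mem_nhds hu)).isSymmSndFDerivAt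
      (by simpa using WithTop.coe_le_coe.mpr (le_top : (2 : ℕ∞) ≤ ⊤))
  rw [partialD, h, partialD, h]
  exact hs.eq _ _

theorem partialD_congr {f g : RSpace n → F} (hB : IsOpen B) (h : ∀ v ∈ B, f v = g v) (hu : u ∈ B)
    (i : Fin n) : partialD i f u = partialD i g u := by
  have : f =ᶠ[nhds u] g := Filter.eventuallyEq_of_mem (hB.mem_nhds hu) h
  rw [partialD, partialD, this.fderiv_eq]

theorem partialD_const (i : Fin n) (c : F) : partialD i (fun _ : RSpace n => c) u = 0 := by
  simp [partialD]

theorem partialD_add {f g : RSpace n → F} (hf : DifferentiableAt ℝ f u)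
    (hg : DifferentiableAt ℝ g u) (i : Fin n) :
    partialD i (fun v => f v + g v) u = partialD i f u + partialD i g u := by
  simp [partialD, fderiv_fun_add hf hg]

theorem partialD_sub {f g : RSpace n → F} (hf : DifferentiableAt ℝ f u)
    (hg : DifferentiableAt ℝ g u) (i : Fin n) :
    partialD i (fun v => f v - g v) u = partialD i f u - partialD i g u := by
  simp [partialD, fderiv_fun_sub hf hg]

theorem partialD_neg {f : RSpace n → F} (i : Fin n) :
    partialD i (fun v => - f v) u = - partialD i f u := by
  simp [partialD, fderiv_fun_neg]

theorem partialD_sum {ι : Type*} (s : Finset ι) {f : ι → RSpace n → F}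
    (hf : ∀ k ∈ s, DifferentiableAt ℝ (f k) u) (i : Fin n) :
    partialD i (fun v => ∑ k ∈ s, f k v) u = ∑ k ∈ s, partialD i (f k) u := by
  simp [partialD, fderiv_fun_sum hf]

theorem partialD_smul {a : RSpace n → ℝ} {f : RSpace n → F} (ha : DifferentiableAt ℝ a u)
    (hf : DifferentiableAt ℝ f u) (i : Fin n) :
    partialD i (fun v => a v • f v) u = a u • partialD i f u + partialD i a u • f u := by
  simp [partialD, fderiv_fun_smul ha hf]

theorem partialD_mul {a b : RSpace n → ℝ} (ha : DifferentiableAt ℝ a u)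
    (hb : DifferentiableAt ℝ b u) (i : Fin n) :
    partialD i (fun v => a v * b v) u = a u * partialD i b u + partialD i a u * b u :=
  partialD_smul ha hb i

theorem partialD_clm (L : F →L[ℝ] G) {f : RSpace n → F} (hf : DifferentiableAt ℝ f u)
    (i : Fin n) : partialD i (fun v => L (f v)) u = L (partialD i f u) := by
  have := L.hasFDerivAt.comp u hf.hasFDerivAt
  change fderiv ℝ (L ∘ f) u _ = _
  rw [this.fderiv]
  rfl

theorem partialD_inner {E : Type*} [NormedAddCommGroup E] [InnerProductSpace ℝ E]
    {f g : RSpace n → E} (hf : DifferentiableAt ℝ f u)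
    (hg : DifferentiableAt ℝ g u) (i : Fin n) :
    partialD i (fun v => (inner ℝ (f v) (g v) : ℝ)) u
      = inner ℝ (f u) (partialD i g u) + inner ℝ (partialD i f u) (g u) := by
  simp [partialD, fderiv_inner_apply ℝ hf hg]

/-- A closed `1`-form `∑ aᵢ duᵢ` on a convex open set is the differential of a function. -/
theorem exists_partialD_eq (hB : IsOpen B) (hc : Convex ℝ B) {a : Fin n → RSpace n → ℝ}
    (ha : ∀ i, ContDiffOn ℝ ∞ (a i) B)
    (hcl : ∀ v ∈ B, ∀ i j, partialD i (a j) v = partialD j (a i) v) :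
    ∃ φ : RSpace n → ℝ, ContDiffOn ℝ ∞ φ B ∧ ∀ v ∈ B, ∀ i, partialD i φ v = a i v := by
  set η : RSpace n → RSpace n →L[ℝ] ℝ := fun v => ∑ i, a i v • EuclideanSpace.proj i with hη
  have hηs : ContDiffOn ℝ ∞ η B :=
    ContDiffOn.sum fun i _ => (ha i).smul contDiffOn_const
  have hfd : ∀ v ∈ B, ∀ x y, fderiv ℝ η v x y = ∑ i, ∑ j, x j * y i * partialD j (a i) v := by
    intro v hv x y
    have h1 : HasFDerivAt η (∑ i, (fderiv ℝ (a i) v).smulRight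
        (EuclideanSpace.proj i : RSpace n →L[ℝ] ℝ)) v := by
      apply HasFDerivAt.fun_sum
      intro i _
      exact (differentiableAt_of_contDiffOn hB (ha i) hv).hasFDerivAt.smul_const
        (EuclideanSpace.proj i : RSpace n →L[ℝ] ℝ)
    rw [h1.fderiv]
    simp only [sum_apply, ContinuousLinearMap.smulRight_apply,
      smul_apply, fderiv_apply_eq_sum_partialD (a _), smul_eq_mul,
      Finset.sum_mul]
    exact Finset.sum_congr rfl fun i _ => Finset.sum_congr rfl fun j _ => by
      change _ * y i = _
      ring
  obtain ⟨φ, hφ⟩ := hc.exists_forall_hasFDerivAt_of_fderiv_symmetric hB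
    (hηs.differentiableOn (by simp)) (fun v hv x y => by
      rw [hfd v hv, hfd v hv, Finset.sum_comm]
      refine Finset.sum_congr rfl fun i _ => Finset.sum_congr rfl fun j _ => ?_
      rw [hcl v hv i j]
      ring)
  refine ⟨φ, ?_, fun v hv i => ?_⟩
  · have h2 : ContDiffOn ℝ (∞ + 1) φ B := by
      rw [contDiffOn_succ_iff_fderiv_of_isOpen hB]
      refine ⟨fun v hv => (hφ v hv).differentiableAt.differentiableWithinAt, by simp, ?_⟩
      exact hηs.congr fun v hv => (hφ v hv).fderiv
    simpa using h2
  · rw [partialD, (hφ v hv).fderiv]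
    simp [hη]

end Calculus

/-! ### Planar self-shrinking curves: global existence and uniqueness -/

section AbreschLanger

/-- The vector field on `ℂ × ℂ` whose integral curves with `‖w‖ = 1` are the pairs `(γ, γ')`
for `γ` a self-shrinking curve parametrized by arc length. -/
noncomputable def shrinkerField (p : ℂ × ℂ) : ℂ × ℂ :=
  (p.2, -((inner ℝ p.1 (Complex.I * p.2) : ℝ) • (Complex.I * p.2)))

theorem contDiff_shrinkerField : ContDiff ℝ ∞ shrinkerField := by
  have h : ContDiff ℝ ∞ fun p : ℂ × ℂ => (inner ℝ p.1 (Complex.I * p.2) : ℝ) :=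
    contDiff_fst.inner ℝ (contDiff_const.mul contDiff_snd)
  unfold shrinkerField
  fun_prop

theorem hasDerivAt_prod_fst {E F : Type*} [NormedAddCommGroup E] [NormedSpace ℝ E]
    [NormedAddCommGroup F] [NormedSpace ℝ F] {σ : ℝ → E × F} {σ' : E × F} {t : ℝ}
    (h : HasDerivAt σ σ' t) : HasDerivAt (fun t => (σ t).1) σ'.1 t :=
  (ContinuousLinearMap.fst ℝ E F).hasFDerivAt.comp_hasDerivAt t h

theorem hasDerivAt_prod_snd {E F : Type*} [NormedAddCommGroup E] [NormedSpace ℝ E]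
    [NormedAddCommGroup F] [NormedSpace ℝ F] {σ : ℝ → E × F} {σ' : E × F} {t : ℝ}
    (h : HasDerivAt σ σ' t) : HasDerivAt (fun t => (σ t).2) σ'.2 t :=
  (ContinuousLinearMap.snd ℝ E F).hasFDerivAt.comp_hasDerivAt t h

/-- For unit `w` the pair `w`, `i w` is a real orthonormal basis of ℂ, so removing the `w`-component
is projecting onto `i w`. -/
theorem shrinkerField_snd (z w : ℂ) (hw : ‖w‖ = 1) :
    (shrinkerField (z, w)).2 = -(z - (inner ℝ z w : ℝ) • w) := by
  have h : w.re * w.re + w.im * w.im = 1 := by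
    rw [← Complex.normSq_apply, Complex.normSq_eq_norm_sq, hw]; norm_num
  apply Complex.ext
  · simp [shrinkerField, Complex.inner]
    linear_combination (-z.re) * h
  · simp [shrinkerField, Complex.inner]
    linear_combination (-z.im) * h

/-- The self-shrinker equation in terms of the position and the (rescaled) angle of the tangent. -/
noncomputable def angleField (C : ℝ) (p : ℂ × ℝ) : ℂ × ℝ :=
  (Complex.exp ((C * p.2 : ℝ) * Complex.I),
    -(inner ℝ p.1 (Complex.I * Complex.exp ((C * p.2 : ℝ) * Complex.I)) / C))

/-- Up to time `a` the position stays within ‖z‖ + a of the origin, so the tangent angle turns at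
rate at most ‖z‖ + a. Dividing the angle by a larger constant `C` gives a field bounded by 1 on the
ball of radius `a`, and Picard–Lindelöf then reaches time `a`, which is arbitrary. -/
theorem exists_hasDerivAt_shrinkerField (z w : ℂ) (hw : ‖w‖ = 1) (a : ℝ) :
    ∃ σ : ℝ → ℂ × ℂ, σ 0 = (z, w) ∧
      ∀ t ∈ Set.Ioo (-a) a, HasDerivAt σ (shrinkerField (σ t)) t := by
  rcases le_or_gt a 0 with ha | ha
  · exact ⟨fun _ => (z, w), rfl, fun t ht => by have := ht.1.trans ht.2; linarith⟩
  set C : ℝ := ‖z‖ + a + 1 with hC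
  have hCpos : 0 < C := by positivity
  set p₀ : ℂ × ℝ := (z, w.arg / C) with hp₀
  lift a to NNReal using ha.le
  have hsm : ContDiff ℝ 1 (angleField C) := by
    have h1 : ContDiff ℝ 1 fun p : ℂ × ℝ => Complex.exp ((C * p.2 : ℝ) * Complex.I) :=
      ((Complex.ofRealCLM.contDiff.comp (contDiff_const.mul contDiff_snd)).mul
        contDiff_const).cexp
    exact h1.prodMk (((contDiff_fst.inner ℝ (contDiff_const.mul h1)).div_const C).neg)
  obtain ⟨K, hK⟩ : ∃ K, LipschitzOnWith K (angleField C) (Metric.closedBall p₀ a) :=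
    hsm.contDiffOn.exists_lipschitzOnWith (by simp) (convex_closedBall _ _)
      (isCompact_closedBall _ _)
  have hexp : ∀ r : ℝ, ‖Complex.exp ((r : ℝ) * Complex.I)‖ = 1 := Complex.norm_exp_ofReal_mul_I
  have hPL : IsPicardLindelof (fun _ => angleField C)
      (tmin := -a) (tmax := a) ⟨0, by simp⟩ p₀ a 0 1 K := by
    apply IsPicardLindelof.of_time_independent _ hK
    · simp
    · intro p hp
      rw [angleField, Prod.norm_mk]
      refine max_le ?_ ?_
      · exact (hexp _).le
      · rw [norm_neg, norm_div, Real.norm_of_nonneg hCpos.le]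
        simp only [NNReal.coe_one]
        rw [div_le_one hCpos]
        refine (norm_inner_le_norm _ _).trans ?_
        rw [norm_mul, hexp, Complex.norm_I, mul_one, mul_one]
        have h1 : ‖p.1 - z‖ ≤ a := by
          have := (norm_fst_le (p - p₀)).trans (mem_closedBall_iff_norm.mp hp)
          simpa [hp₀] using this
        have := norm_le_norm_add_norm_sub' p.1 z
        linarith
  obtain ⟨α, h0, hα⟩ := hPL.exists_eq_forall_mem_Icc_hasDerivWithinAt₀
  refine ⟨fun t => ((α t).1, Complex.exp ((C * (α t).2 : ℝ) * Complex.I)), ?_, fun t ht => ?_⟩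
  · beta_reduce
    rw [show α 0 = p₀ from h0, hp₀, mul_div_cancel₀ _ hCpos.ne']
    have := Complex.norm_mul_exp_arg_mul_I w
    rw [hw] at this
    simpa using this
  · have hd := (hα t ⟨ht.1.le, ht.2.le⟩).hasDerivAt (Icc_mem_nhds ht.1 ht.2)
    have h1 : HasDerivAt (fun t => (α t).1) (angleField C (α t)).1 t := hasDerivAt_prod_fst hd
    have h2 : HasDerivAt (fun t => (α t).2) (angleField C (α t)).2 t := hasDerivAt_prod_snd hd
    have h3 := (((h2.const_mul C).ofReal_comp).mul_const Complex.I).cexp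
    refine h1.prodMk (h3.congr_deriv ?_)
    simp only [angleField]
    push_cast
    have : (C : ℂ) ≠ 0 := by exact_mod_cast hCpos.ne'
    simp only [Complex.real_smul]
    field_simp

/-- Solutions on the intervals (-a, a) agree by uniqueness, so they glue to a solution on ℝ. -/
theorem exists_forall_hasDerivAt_shrinkerField (z w : ℂ) (hw : ‖w‖ = 1) :
    ∃ σ : ℝ → ℂ × ℂ, σ 0 = (z, w) ∧ ∀ t, HasDerivAt σ (shrinkerField (σ t)) t := by
  have hv : ContMDiff 𝓘(ℝ, ℂ × ℂ) 𝓘(ℝ, ℂ × ℂ).tangent 1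
      (fun x => (⟨x, shrinkerField x⟩ : TangentBundle 𝓘(ℝ, ℂ × ℂ) (ℂ × ℂ))) :=
    contMDiff_vectorSpace_iff_contDiff.mpr (contDiff_shrinkerField.of_le (by simp))
  obtain ⟨σ, h0, hσ⟩ := (exists_isMIntegralCurve_iff_exists_isMIntegralCurveOn_Ioo hv (z, w)).mpr
    fun a => by
      obtain ⟨σ, h0, hσ⟩ := exists_hasDerivAt_shrinkerField z w hw a
      exact ⟨σ, h0, fun t ht => HasFDerivWithinAt.hasMFDerivWithinAt
        (HasDerivAt.hasFDerivAt (hσ t ht)).hasFDerivWithinAt⟩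
  exact ⟨σ, h0, fun t => (hσ t).hasFDerivAt⟩

/-- The derivative of the second component `w` is a real multiple of `i w`, which is orthogonal to
`w`. -/
theorem norm_snd_eq_one_of_hasDerivAt_shrinkerField {σ : ℝ → ℂ × ℂ}
    (hσ : ∀ t, HasDerivAt σ (shrinkerField (σ t)) t) (h0 : ‖(σ 0).2‖ = 1) (t : ℝ) :
    ‖(σ t).2‖ = 1 := by
  have hd : ∀ t, HasDerivAt (fun t => ‖(σ t).2‖ ^ 2) 0 t := fun t => by
    refine ((hasDerivAt_prod_snd (hσ t)).norm_sq).congr_deriv ?_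
    simp [shrinkerField, Complex.inner]
    ring
  have hc := is_const_of_deriv_eq_zero (fun t => (hd t).differentiableAt)
    (fun t => (hd t).deriv) t 0
  simp only [h0] at hc
  nlinarith [norm_nonneg (σ t).2]

/-- A short self-shrinking curve parametrized by arc length extends to an Abresch–Langer curve. -/
theorem exists_isAbreschLangerCurve_eventuallyEq {γ : ℝ → ℂ} {S : Set ℝ} {s₀ : ℝ}
    (hS : IsOpen S) (hs₀ : s₀ ∈ S) (hγ : ContDiffOn ℝ ∞ γ S) (hu : ∀ s ∈ S, ‖deriv γ s‖ = 1)
    (hs : ∀ s ∈ S,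
      deriv (deriv γ) s = -(γ s - (inner ℝ (γ s) (deriv γ s) : ℝ) • deriv γ s)) :
    ∃ Γ : ℝ → ℂ, IsAbreschLangerCurve Γ ∧ Γ =ᶠ[nhds s₀] γ := by
  obtain ⟨σ, h0, hσ⟩ := exists_forall_hasDerivAt_shrinkerField (γ s₀) (deriv γ s₀)
    (hu s₀ hs₀)
  have hn := norm_snd_eq_one_of_hasDerivAt_shrinkerField hσ (by rw [h0]; exact (hu s₀ hs₀))
  have hd1 : deriv (fun t => (σ t).1) = fun t => (σ t).2 := funext fun t => (hasDerivAt_prod_fst (hσ t)).deriv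
  have hAL : IsAbreschLangerCurve fun t => (σ t).1 := by
    refine ⟨?_, fun t => ?_, fun t => ?_⟩
    -- Bootstrapping: σ' is the composite of a smooth field with σ, so it is as regular as σ.
    · have hk : ∀ k : ℕ, ContDiff ℝ k σ := by
        intro k
        induction k with
        | zero => exact contDiff_zero.mpr (continuous_iff_continuousAt.mpr fun t =>
            (hσ t).continuousAt)
        | succ k ih =>
          push_cast
          rw [contDiff_succ_iff_deriv]
          refine ⟨fun t => (hσ t).differentiableAt, by simp, ?_⟩
          have : deriv σ = shrinkerField ∘ σ := funext fun t => (hσ t).deriv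
          rw [this]
          exact (contDiff_shrinkerField.of_le (by exact_mod_cast le_top)).comp ih
      exact (contDiff_infty.mpr hk).fst
    · rw [hd1]
      exact hn t
    · rw [hd1, (hasDerivAt_prod_snd (hσ t)).deriv]
      exact shrinkerField_snd _ _ (hn t)
  have hsh : ∀ t, HasDerivAt (fun t => σ (t - s₀)) (shrinkerField (σ (t - s₀))) t := fun t => 
    (hσ (t - s₀)).comp_sub_const t s₀
  refine ⟨fun t => (σ (t - s₀)).1, ?_, ?_⟩
  · have e1 : deriv (fun t => (σ (t - s₀)).1) = fun t => (σ (t - s₀)).2 :=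
      funext fun t => (hasDerivAt_prod_fst (hsh t)).deriv
    refine ⟨hAL.smooth.comp (contDiff_id.sub contDiff_const), fun t => ?_, fun t => ?_⟩
    · rw [e1]
      exact hn _
    · rw [e1, (hasDerivAt_prod_snd (hsh t)).deriv]
      exact shrinkerField_snd _ _ (hn _)
  -- The pair (γ, γ') solves the same locally Lipschitz ODE with the same value at s₀, so local
  -- uniqueness identifies the two curves.
  · obtain ⟨K, N, hN, hK⟩ := (contDiff_shrinkerField.contDiffAt (x := (γ s₀, deriv γ s₀))
      |>.of_le (m := 1) (by simp)).exists_lipschitzOnWith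
    have hγ' : ContDiffOn ℝ ∞ (deriv γ) S := hγ.deriv_of_isOpen hS (by simp)
    have hγc : ContinuousAt (fun t => (γ t, deriv γ t)) s₀ :=
      (hγ.contDiffAt (hS.mem_nhds hs₀)).continuousAt.prodMk
        (hγ'.contDiffAt (hS.mem_nhds hs₀)).continuousAt
    have key := ODE_solution_unique_of_eventually (v := fun _ => shrinkerField) (s := fun _ => N)
      (f := fun t => σ (t - s₀)) (g := fun t => (γ t, deriv γ t)) (t₀ := s₀) (K := K)
      (Filter.Eventually.of_forall fun _ => hK)
      (by
        have : ContinuousAt (fun t => σ (t - s₀)) s₀ := (hsh s₀).continuousAt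
        have h2 := this.preimage_mem_nhds (t := N) (by simpa [h0] using hN)
        filter_upwards [h2] with t ht
        exact ⟨hsh t, ht⟩)
      (by
        filter_upwards [hS.mem_nhds hs₀, hγc.preimage_mem_nhds hN] with t ht h4
        refine ⟨?_, h4⟩
        have hd : DifferentiableAt ℝ γ t :=
          (hγ.contDiffAt (hS.mem_nhds ht)).differentiableAt (by simp)
        have hd' : DifferentiableAt ℝ (deriv γ) t :=
          (hγ'.contDiffAt (hS.mem_nhds ht)).differentiableAt (by simp)
        refine hd.hasDerivAt.prodMk (hd'.hasDerivAt.congr_deriv ?_)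
        rw [hs t ht, ← shrinkerField_snd _ _ (hu t ht)]
        rfl)
      (by simp [h0])
    filter_upwards [key] with t ht
    exact congrArg Prod.fst ht

end AbreschLanger

/-! ### Real and Hermitian inner products on ℂ² -/

section UnitaryFrame

theorem inner_real_eq_re (v w : C2) : inner ℝ v w = (inner ℂ v w).re :=
  ClosedSubmodule.inner_real_eq_re_inner v w

theorem inner_I_smul_left (v w : C2) : inner ℝ (Complex.I • v) w = (inner ℂ v w).im := by
  rw [inner_real_eq_re, inner_smul_left]
  simp

theorem inner_I_smul_eq_neg (v w : C2) :
    inner ℝ (Complex.I • v) w = -inner ℝ v (Complex.I • w) := by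
  rw [inner_I_smul_left, inner_real_eq_re, inner_smul_right]
  simp

theorem inner_I_smul_I_smul (v w : C2) :
    inner ℝ (Complex.I • v) (Complex.I • w) = inner ℝ v w := by
  rw [inner_I_smul_eq_neg, smul_smul, Complex.I_mul_I]
  simp

theorem inner_I_smul_swap (v w : C2) :
    inner ℝ (Complex.I • v) w = -inner ℝ (Complex.I • w) v := by
  rw [inner_I_smul_eq_neg, real_inner_comm]

/-- The real part of the Hermitian product is the Euclidean product and its imaginary part is the
symplectic form. Hence a real orthonormal tangent frame of a Lagrangian surface is the same thing as
a unitary frame. -/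
theorem orthonormal_complex_iff {e : Fin 2 → C2} : Orthonormal ℂ e ↔
    (∀ j k, inner ℝ (e j) (e k) = if j = k then (1 : ℝ) else 0) ∧
      ∀ j k, inner ℝ (Complex.I • e j) (e k) = 0 := by
  rw [orthonormal_iff_ite]
  simp only [inner_real_eq_re (e _), inner_I_smul_left, ← forall_and]
  refine forall_congr' fun j => forall_congr' fun k => ?_
  rw [Complex.ext_iff]
  split_ifs <;> simp

theorem Orthonormal.eq_sum_frame {e : Fin 2 → C2} (he : Orthonormal ℂ e) (v : C2) :
    v = ∑ k, ((inner ℝ (e k) v : ℝ) • e k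
      + (inner ℝ (Complex.I • e k) v : ℝ) • Complex.I • e k) := by
  let b := basisOfOrthonormalOfCardEqFinrank he (by simp)
  have hb : ⇑b = e := coe_basisOfOrthonormalOfCardEqFinrank he (by simp)
  let o : OrthonormalBasis (Fin 2) ℂ C2 := b.toOrthonormalBasis (by rw [hb]; exact he)
  have ho : ⇑o = e := by rw [Module.Basis.coe_toOrthonormalBasis, hb]
  conv_lhs => rw [← o.sum_repr' v]
  refine Finset.sum_congr rfl fun k _ => ?_
  rw [ho, inner_I_smul_left, inner_real_eq_re]
  conv_lhs => rw [← Complex.re_add_im (inner ℂ (e k) v), add_smul, mul_smul]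
  simp

theorem Orthonormal.inner_eq_sum_frame {e : Fin 2 → C2} (he : Orthonormal ℂ e) (v w : C2) :
    inner ℝ v w = ∑ k, ((inner ℝ (e k) v : ℝ) * inner ℝ (e k) w
      + (inner ℝ (Complex.I • e k) v : ℝ) * inner ℝ (Complex.I • e k) w) := by
  conv_lhs => rw [Orthonormal.eq_sum_frame he v]
  simp only [sum_inner, inner_add_left, real_inner_smul_left]

theorem partialD_I_smul {n : ℕ} {f : RSpace n → C2} {u : RSpace n}
    (hf : DifferentiableAt ℝ f u) (i : Fin n) :
    partialD i (fun v => Complex.I • f v) u = Complex.I • partialD i f u := by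
  simp [partialD, fderiv_fun_const_smul hf]

theorem contDiffOn_I_smul {n : ℕ} {f : RSpace n → C2} {B : Set (RSpace n)}
    (hf : ContDiffOn ℝ ∞ f B) : ContDiffOn ℝ ∞ (fun v => Complex.I • f v) B :=
  hf.const_smul Complex.I

theorem differentiableAt_I_smul {n : ℕ} {f : RSpace n → C2} {u : RSpace n}
    (hf : DifferentiableAt ℝ f u) : DifferentiableAt ℝ (fun v => Complex.I • f v) u :=
  hf.const_smul Complex.I

end UnitaryFrame

/-! ### The cubic form in flat coordinates: symmetry, Gauss and Codazzi equations -/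

/-- `F` parametrizes a Lagrangian self-shrinker by flat coordinates: the induced metric
is the standard one, and the frame `∂₀F, ∂₁F` is unitary. -/
structure IsFlatLagrangianShrinker (F : RSpace 2 → C2) (B : Set (RSpace 2)) : Prop where
  contDiffOn : ContDiffOn ℝ ∞ F B
  orthonormal : ∀ u ∈ B, Orthonormal ℂ fun j => partialD j F u
  shrinker : ∀ u ∈ B, partialD 0 (partialD 0 F) u + partialD 1 (partialD 1 F) u
    = -(F u - ∑ k, (inner ℝ (F u) (partialD k F u) : ℝ) • partialD k F u)

/-- The cubic form `⟪i ∂ₗF, ∂ⱼ∂ₖF⟫`. -/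
noncomputable def cubic (F : RSpace 2 → C2) (j k l : Fin 2) (u : RSpace 2) : ℝ :=
  inner ℝ (Complex.I • partialD l F u) (partialD j (partialD k F) u)

namespace IsFlatLagrangianShrinker

variable {F : RSpace 2 → C2} {B : Set (RSpace 2)} {u : RSpace 2}

theorem contDiffOn_cubic (hB : IsOpen B) (hF : ContDiffOn ℝ ∞ F B) (j k l : Fin 2) :
    ContDiffOn ℝ ∞ (cubic F j k l) B :=
  (contDiffOn_I_smul (contDiffOn_partialD hB hF l)).inner ℝ
    (contDiffOn_partialD hB (contDiffOn_partialD hB hF k) j)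

theorem mono (hF : IsFlatLagrangianShrinker F B) {B' : Set (RSpace 2)} (h : B' ⊆ B) :
    IsFlatLagrangianShrinker F B' :=
  ⟨hF.1.mono h, fun u hu => hF.2 u (h hu), fun u hu => hF.3 u (h hu)⟩

/-- The Koszul argument: the metric coefficients are constant, so the Christoffel symbols vanish. -/
theorem inner_second_eq_zero (hF : IsFlatLagrangianShrinker F B) (hB : IsOpen B)
    (hu : u ∈ B) (j k l : Fin 2) :
    inner ℝ (partialD l F u) (partialD j (partialD k F) u) = 0 := by
  have hd : ∀ i, DifferentiableAt ℝ (partialD i F) u := fun i =>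
    differentiableAt_of_contDiffOn hB (contDiffOn_partialD hB hF.1 i) hu
  have key : ∀ i a b : Fin 2, inner ℝ (partialD a F u) (partialD i (partialD b F) u)
      + inner ℝ (partialD b F u) (partialD i (partialD a F) u) = (0 : ℝ) := by
    intro i a b
    have h1 := partialD_congr (f := fun v => inner ℝ (partialD a F v) (partialD b F v))
      (g := fun _ => if a = b then (1 : ℝ) else 0) hB
      (fun v hv => (orthonormal_complex_iff.mp (hF.orthonormal v hv)).1 a b) hu i
    rw [partialD_const, partialD_inner (hd a) (hd b)] at h1
    rwa [real_inner_comm (partialD i (partialD a F) u)]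
  have c := fun a b => partialD_comm hB hF.1 hu a b
  have h1 := key j k l
  have h2 := key k l j
  have h3 := key l j k
  rw [c k j] at h2
  rw [c l k, c l j] at h3
  linarith

theorem cubic_comm (hF : IsFlatLagrangianShrinker F B) (hB : IsOpen B)
    (hu : u ∈ B) (j k l : Fin 2) : cubic F j k l u = cubic F k j l u := by
  rw [cubic, partialD_comm hB hF.1 hu, cubic]

/-- Differentiating the Lagrangian condition ⟪i∂ₗF, ∂ₖF⟫ = 0 along ∂ⱼ. With `cubic_comm` this makes
the cubic form totally symmetric. -/
theorem cubic_swap (hF : IsFlatLagrangianShrinker F B) (hB : IsOpen B)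
    (hu : u ∈ B) (j k l : Fin 2) : cubic F j k l u = cubic F j l k u := by
  have hd : ∀ i, DifferentiableAt ℝ (partialD i F) u := fun i =>
    differentiableAt_of_contDiffOn hB (contDiffOn_partialD hB hF.1 i) hu
  have h1 := partialD_congr
    (f := fun v => inner ℝ (Complex.I • partialD l F v) (partialD k F v))
    (g := fun _ => (0 : ℝ)) hB
    (fun v hv => (orthonormal_complex_iff.mp (hF.orthonormal v hv)).2 l k) hu j
  rw [partialD_const, partialD_inner (differentiableAt_I_smul (hd l)) (hd k),
    partialD_I_smul (hd l), inner_I_smul_swap (partialD j _ u)] at h1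
  rw [cubic, cubic]
  linarith

theorem second_eq_sum (hF : IsFlatLagrangianShrinker F B) (hB : IsOpen B)
    (hu : u ∈ B) (j k : Fin 2) : partialD j (partialD k F) u
    = ∑ l, cubic F j k l u • Complex.I • partialD l F u := by
  conv_lhs => rw [Orthonormal.eq_sum_frame (hF.orthonormal u hu) (partialD j (partialD k F) u)]
  simp only [hF.inner_second_eq_zero hB hu, zero_smul, zero_add]
  rfl

theorem inner_second_second (hF : IsFlatLagrangianShrinker F B) (hB : IsOpen B)
    (hu : u ∈ B) (i j k l : Fin 2) :
    inner ℝ (partialD i (partialD j F) u) (partialD k (partialD l F) u)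
      = ∑ m, cubic F i j m u * cubic F k l m u := by
  rw [Orthonormal.inner_eq_sum_frame (hF.orthonormal u hu)]
  simp only [hF.inner_second_eq_zero hB hu, zero_mul, zero_add]
  rfl

/-- The term in which the derivative falls on ∂ₗF drops out: i∂ₘ∂ₗF is tangent, while ∂ⱼ∂ₖF is
normal. -/
theorem partialD_cubic (hF : IsFlatLagrangianShrinker F B) (hB : IsOpen B)
    (hu : u ∈ B) (m j k l : Fin 2) :
    partialD m (cubic F j k l) u
      = inner ℝ (Complex.I • partialD l F u) (partialD m (partialD j (partialD k F)) u) := by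
  have h1 := contDiffOn_partialD hB hF.1 l
  have h2 := contDiffOn_partialD hB (contDiffOn_partialD hB hF.1 k) j
  have d1 := differentiableAt_of_contDiffOn hB h1 hu
  have d2 := differentiableAt_of_contDiffOn hB h2 hu
  change partialD m (fun v => inner ℝ (Complex.I • partialD l F v)
    (partialD j (partialD k F) v)) u = _
  rw [partialD_inner (differentiableAt_I_smul d1) d2, partialD_I_smul d1, add_eq_left,
    hF.second_eq_sum hB hu m l, hF.second_eq_sum hB hu j k]
  have := (orthonormal_complex_iff.mp (hF.orthonormal u hu)).2
  simp only [Finset.smul_sum, sum_inner, inner_sum, smul_comm Complex.I (_ : ℝ),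
    real_inner_smul_left, real_inner_smul_right, inner_I_smul_I_smul, this]
  simp

theorem codazzi (hF : IsFlatLagrangianShrinker F B) (hB : IsOpen B)
    (hu : u ∈ B) (m j k l : Fin 2) :
    partialD m (cubic F j k l) u = partialD j (cubic F m k l) u := by
  rw [hF.partialD_cubic hB hu, hF.partialD_cubic hB hu,
    partialD_comm hB (contDiffOn_partialD hB hF.1 k) hu]

/-- Both sides equal −⟪∂₁F, ∂₀∂₀∂₁F⟫, as one sees by differentiating ⟪∂ₗF, ∂ⱼ∂ₖF⟫ = 0 and commuting
third derivatives. -/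
theorem gauss (hF : IsFlatLagrangianShrinker F B) (hB : IsOpen B)
    (hu : u ∈ B) : inner ℝ (partialD 0 (partialD 0 F) u) (partialD 1 (partialD 1 F) u)
    = (inner ℝ (partialD 0 (partialD 1 F) u) (partialD 0 (partialD 1 F) u) : ℝ) := by
  have h1 := fun i => contDiffOn_partialD hB hF.1 i
  have h2 := fun i j => contDiffOn_partialD hB (h1 j) i
  have d1 := fun i => differentiableAt_of_contDiffOn hB (h1 i) hu
  have d2 := fun i j => differentiableAt_of_contDiffOn hB (h2 i j) hu
  have key : ∀ i j k l : Fin 2,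
      inner ℝ (partialD l F u) (partialD i (partialD j (partialD k F)) u)
        + inner ℝ (partialD i (partialD l F) u) (partialD j (partialD k F) u) = (0 : ℝ) := by
    intro i j k l
    have := partialD_congr
      (f := fun v => inner ℝ (partialD l F v) (partialD j (partialD k F) v))
      (g := fun _ => (0 : ℝ)) hB (fun v hv => hF.inner_second_eq_zero hB hv j k l) hu i
    rwa [partialD_const, partialD_inner (d1 l) (d2 j k)] at this
  have e1 := key 1 0 0 1
  have e2 := key 0 0 1 1
  have e3 : partialD 1 (partialD 0 (partialD 0 F)) u = partialD 0 (partialD 0 (partialD 1 F)) u := by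
    rw [partialD_comm hB (h1 0) hu]
    exact partialD_congr hB (fun v hv => partialD_comm hB hF.1 hv 1 0) hu 0
  rw [e3] at e1
  rw [real_inner_comm]
  linarith

theorem trace_cubic (hF : IsFlatLagrangianShrinker F B)
    (hu : u ∈ B) (l : Fin 2) : cubic F 0 0 l u + cubic F 1 1 l u
    = -inner ℝ (Complex.I • partialD l F u) (F u) := by
  rw [cubic, cubic, ← inner_add_right, hF.shrinker u hu, inner_neg_right, inner_sub_right,
    inner_sum]
  have := (orthonormal_complex_iff.mp (hF.orthonormal u hu)).2
  simp [real_inner_smul_right, this]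

/-- The derivative of −⟪i∂ₗF, F⟫: the part containing ⟪i∂ₗF, ∂ₘF⟫ vanishes, and in the other i∂ₘ∂ₗF
= −∑ C_{mlk} ∂ₖF. -/
theorem partialD_trace_cubic (hF : IsFlatLagrangianShrinker F B) (hB : IsOpen B)
    (hu : u ∈ B) (m l : Fin 2) :
    partialD m (cubic F 0 0 l) u + partialD m (cubic F 1 1 l) u
      = ∑ k, cubic F m l k u * inner ℝ (partialD k F u) (F u) := by
  have h1 := contDiffOn_partialD hB hF.1 l
  have d1 := differentiableAt_of_contDiffOn hB h1 hu
  have dc := fun i => differentiableAt_of_contDiffOn hB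
    (contDiffOn_cubic hB hF.1 i i l) hu
  have := partialD_congr (f := fun v => cubic F 0 0 l v + cubic F 1 1 l v)
    (g := fun v => -inner ℝ (Complex.I • partialD l F v) (F v)) hB
    (fun v hv => hF.trace_cubic hv l) hu m
  rw [partialD_add (dc 0) (dc 1), partialD_neg, partialD_inner (differentiableAt_I_smul d1)
    (differentiableAt_of_contDiffOn hB hF.1 hu), partialD_I_smul d1,
    (orthonormal_complex_iff.mp (hF.orthonormal u hu)).2, zero_add,
    hF.second_eq_sum hB hu m l] at this
  rw [this, Finset.smul_sum, sum_inner, ← Finset.sum_neg_distrib]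
  refine Finset.sum_congr rfl fun k _ => ?_
  rw [smul_comm Complex.I, smul_smul Complex.I, Complex.I_mul_I, neg_one_smul, smul_neg,
    inner_neg_left, neg_neg, real_inner_smul_left]

end IsFlatLagrangianShrinker

/-! ### Algebra behind the constancy of the quotient τ/η -/

section PointwiseAlgebra

/-- The unimodular function `p + iq`, quotient of the traceless part of the cubic form by the
conjugate of its trace, is holomorphic, hence has vanishing differential. -/
theorem differential_quotient_eq_zero
    {a0 a1 a2 a3 y0 y1 p q p0 p1 q0 q1 d0 d1 d2 d3 d4 : ℝ}
    (hh : (a0 + a2) ^ 2 + (a1 + a3) ^ 2 ≠ 0)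
    (e1 : a0 - 3 * a2 = p * (a0 + a2) - q * (a1 + a3))
    (e2 : a3 - 3 * a1 = p * (a1 + a3) + q * (a0 + a2))
    (e3 : p ^ 2 + q ^ 2 = 1)
    (s0 : d0 + d2 = a0 * y0 + a1 * y1) (s1 : d1 + d3 = a1 * y0 + a2 * y1)
    (s2 : d2 + d4 = a2 * y0 + a3 * y1)
    (f10 : d0 - 3 * d2 = p0 * (a0 + a2) + p * (d0 + d2) - (q0 * (a1 + a3) + q * (d1 + d3)))
    (f11 : d1 - 3 * d3 = p1 * (a0 + a2) + p * (d1 + d3) - (q1 * (a1 + a3) + q * (d2 + d4)))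
    (f20 : d3 - 3 * d1 = p0 * (a1 + a3) + p * (d1 + d3) + (q0 * (a0 + a2) + q * (d0 + d2)))
    (f21 : d4 - 3 * d2 = p1 * (a1 + a3) + p * (d2 + d4) + (q1 * (a0 + a2) + q * (d1 + d3)))
    (g0 : p * p0 + q * q0 = 0) (g1 : p * p1 + q * q1 = 0) :
    p0 = 0 ∧ p1 = 0 ∧ q0 = 0 ∧ q1 = 0 := by
  -- With f = p + iq and X = ((a0 − a2) y0 + (a1 − a3) y1) + 2i (a1 y0 + a2 y1), a multiple of ∂_z̄
  -- η, `k1` and `k2` are the two parts of f X = conj X, a consequence of τ = f η and |f| = 1.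
  have k1 : p * ((a0 - a2) * y0 + (a1 - a3) * y1) - 2 * q * (a1 * y0 + a2 * y1)
      = (a0 - a2) * y0 + (a1 - a3) * y1 := by
    linear_combination (1 / 2) * (p * y0 + q * y1 - y0) * e1
      + (1 / 2) * (q * y0 - p * y1 + y1) * e2
      + (1 / 2) * ((a0 + a2) * y0 - (a1 + a3) * y1) * e3
  have k2 : q * ((a0 - a2) * y0 + (a1 - a3) * y1) + 2 * p * (a1 * y0 + a2 * y1)
      = -2 * (a1 * y0 + a2 * y1) := by
    linear_combination (1 / 2) * (q * y0 - p * y1 - y1) * e1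
      + (1 / 2) * (-p * y0 - q * y1 - y0) * e2
      - (1 / 2) * ((a1 + a3) * y0 + (a0 + a2) * y1) * e3
  -- Real and imaginary parts, up to sign, of (∂_z̄ f) η = 0; dividing by η ≠ 0 gives the
  -- Cauchy–Riemann equations `n1`, `n2`.
  have m1 : (p0 - q1) * (a0 + a2) - (q0 + p1) * (a1 + a3) = 0 := by
    linear_combination f21 - f10 - k1
      + (1 - p) * (s0 - s2) + 2 * q * s1
  have m2 : (p0 - q1) * (a1 + a3) + (q0 + p1) * (a0 + a2) = 0 := by
    linear_combination -f20 - f11 - k2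
      - q * (s0 - s2) - 2 * (p + 1) * s1
  have n1 : p0 - q1 = 0 := by
    have : (p0 - q1) * ((a0 + a2) ^ 2 + (a1 + a3) ^ 2) = 0 := by
      linear_combination (a0 + a2) * m1 + (a1 + a3) * m2
    exact (mul_eq_zero.mp this).resolve_right hh
  have n2 : q0 + p1 = 0 := by
    have : (q0 + p1) * ((a0 + a2) ^ 2 + (a1 + a3) ^ 2) = 0 := by
      linear_combination (a0 + a2) * m2 - (a1 + a3) * m1
    exact (mul_eq_zero.mp this).resolve_right hh
  -- A Cauchy–Riemann pair of constant modulus has zero differential.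
  have r0 : p0 = 0 := by
    linear_combination p * g0 + q * g1 - p0 * e3 + q ^ 2 * n1 - p * q * n2
  have r1 : q0 = 0 := by
    linear_combination q * g0 - p * g1 - q0 * e3 + p ^ 2 * n2 - p * q * n1
  exact ⟨r0, by linarith, r1, by linarith⟩

/-- By the Gauss equation the squared trace equals the full squared norm a0² + 3 a1² + 3 a2² + a3²
of the cubic form. -/
theorem sq_bounds_of_gauss {a0 a1 a2 a3 : ℝ} (hg : a0 * a2 + a1 * a3 = a1 ^ 2 + a2 ^ 2) :
    a0 ^ 2 ≤ (a0 + a2) ^ 2 + (a1 + a3) ^ 2 ∧ a1 ^ 2 ≤ (a0 + a2) ^ 2 + (a1 + a3) ^ 2 ∧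
      a2 ^ 2 ≤ (a0 + a2) ^ 2 + (a1 + a3) ^ 2 ∧ a3 ^ 2 ≤ (a0 + a2) ^ 2 + (a1 + a3) ^ 2 := by
  have : (a0 + a2) ^ 2 + (a1 + a3) ^ 2 = a0 ^ 2 + 3 * a1 ^ 2 + 3 * a2 ^ 2 + a3 ^ 2 := by
    linear_combination 2 * hg
  rw [this]
  refine ⟨?_, ?_, ?_, ?_⟩ <;> nlinarith [sq_nonneg a0, sq_nonneg a1, sq_nonneg a2, sq_nonneg a3]

end PointwiseAlgebra

/-! ### Propagation of zeros of the mean curvature -/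

namespace IsFlatLagrangianShrinker

variable {F : RSpace 2 → C2} {B : Set (RSpace 2)} {u : RSpace 2}

theorem cubic_gauss (hF : IsFlatLagrangianShrinker F B) (hB : IsOpen B) (hu : u ∈ B) :
    cubic F 0 0 0 u * cubic F 1 1 0 u + cubic F 0 0 1 u * cubic F 1 1 1 u
      = cubic F 0 0 1 u ^ 2 + cubic F 1 1 0 u ^ 2 := by
  have := hF.gauss hB hu
  rw [hF.inner_second_second hB hu, hF.inner_second_second hB hu, Fin.sum_univ_two,
    Fin.sum_univ_two, hF.cubic_swap hB hu 0 1 0, hF.cubic_comm hB hu 0 1 1,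
    hF.cubic_swap hB hu 1 0 1] at this
  rw [this]
  ring

theorem cubic_relations (hF : IsFlatLagrangianShrinker F B) (hB : IsOpen B) (hu : u ∈ B) :
    cubic F 0 1 0 u = cubic F 0 0 1 u ∧ cubic F 1 0 0 u = cubic F 0 0 1 u ∧
    cubic F 0 1 1 u = cubic F 1 1 0 u ∧ cubic F 1 0 1 u = cubic F 1 1 0 u := by
  have h1 := hF.cubic_swap hB hu 0 1 0
  have h2 := hF.cubic_comm hB hu 0 1 0
  have h3 := hF.cubic_comm hB hu 0 1 1
  have h4 := hF.cubic_swap hB hu 1 1 0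
  exact ⟨h1, h2 ▸ h1, by rw [h3, h4], by rw [h4]⟩

/-- The squared length of the mean curvature vector. -/
noncomputable def traceSq (F : RSpace 2 → C2) (u : RSpace 2) : ℝ :=
  (cubic F 0 0 0 u + cubic F 1 1 0 u) ^ 2 + (cubic F 0 0 1 u + cubic F 1 1 1 u) ^ 2

theorem contDiffOn_traceSq (hF : IsFlatLagrangianShrinker F B) (hB : IsOpen B) :
    ContDiffOn ℝ ∞ (traceSq F) B := by
  have h := fun j k l => contDiffOn_cubic hB hF.1 j k l
  exact (((h 0 0 0).add (h 1 1 0)).pow 2).add (((h 0 0 1).add (h 1 1 1)).pow 2)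

theorem sq_cubic_le (hF : IsFlatLagrangianShrinker F B) (hB : IsOpen B) (hu : u ∈ B)
    (j k l : Fin 2) : cubic F j k l u ^ 2 ≤ traceSq F u := by
  obtain ⟨h1, h2, h3, h4⟩ := sq_bounds_of_gauss (hF.cubic_gauss hB hu)
  obtain ⟨r1, r2, r3, r4⟩ := hF.cubic_relations hB hu
  fin_cases j <;> fin_cases k <;> fin_cases l <;>
    simp only [Fin.zero_eta, Fin.mk_one, r1, r2, r3, r4] <;>
    assumption

theorem partialD_traceSq (hF : IsFlatLagrangianShrinker F B) (hB : IsOpen B) (hu : u ∈ B)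
    (m : Fin 2) : partialD m (traceSq F) u
      = ∑ l, ∑ k, 2 * (cubic F 0 0 l u + cubic F 1 1 l u)
        * cubic F m l k u * inner ℝ (partialD k F u) (F u) := by
  have d := fun j k l => differentiableAt_of_contDiffOn hB (contDiffOn_cubic hB hF.1 j k l) hu
  have da : ∀ l, DifferentiableAt ℝ (fun v => cubic F 0 0 l v + cubic F 1 1 l v) u :=
    fun l => (d 0 0 l).add (d 1 1 l)
  have e : traceSq F = fun v => (cubic F 0 0 0 v + cubic F 1 1 0 v)
      * (cubic F 0 0 0 v + cubic F 1 1 0 v) + (cubic F 0 0 1 v + cubic F 1 1 1 v)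
      * (cubic F 0 0 1 v + cubic F 1 1 1 v) := by
    funext v
    simp only [traceSq, sq]
  have e' : ∀ l, partialD m (fun v => cubic F 0 0 l v + cubic F 1 1 l v) u
      = ∑ k, cubic F m l k u * inner ℝ (partialD k F u) (F u) := fun l => by
    rw [partialD_add (d 0 0 l) (d 1 1 l), hF.partialD_trace_cubic hB hu]
  rw [e, partialD_add ((da 0).fun_mul (da 0)) ((da 1).fun_mul (da 1)), partialD_mul (da 0) (da 0),
    partialD_mul (da 1) (da 1), e', e']
  simp only [Fin.sum_univ_two]
  ring

/-- The differential inequality for Grönwall. The derivative of |H|² is quadratic in the cubic form,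
whose entries are bounded by |H| through the Gauss equation; there are four terms, each at most 4
‖F‖ |H|². -/
theorem abs_partialD_traceSq_le (hF : IsFlatLagrangianShrinker F B) (hB : IsOpen B) (hu : u ∈ B)
    (m : Fin 2) : |partialD m (traceSq F) u| ≤ 16 * ‖F u‖ * traceSq F u := by
  have hy : ∀ k, |(inner ℝ (partialD k F u) (F u) : ℝ)| ≤ ‖F u‖ := fun k => by
    have := abs_real_inner_le_norm (partialD k F u) (F u)
    rwa [(hF.orthonormal u hu).1 k, one_mul] at this
  have hG : 0 ≤ traceSq F u := by unfold traceSq; positivity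
  have hc : ∀ j k l, |cubic F j k l u| ≤ √(traceSq F u) := fun j k l =>
    Real.abs_le_sqrt (hF.sq_cubic_le hB hu j k l)
  rw [hF.partialD_traceSq hB hu]
  have hterm : ∀ l k, |2 * (cubic F 0 0 l u + cubic F 1 1 l u)
      * cubic F m l k u * inner ℝ (partialD k F u) (F u)| ≤ 4 * ‖F u‖ * traceSq F u := by
    intro l k
    rw [abs_mul, abs_mul, abs_mul]
    have h1 : |cubic F 0 0 l u + cubic F 1 1 l u| ≤ 2 * √(traceSq F u) :=
      (abs_add_le _ _).trans (by linarith [hc 0 0 l, hc 1 1 l])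
    calc _ ≤ |2| * (2 * √(traceSq F u)) * √(traceSq F u) * ‖F u‖ := by
          gcongr
          · exact hc m l k
          · exact hy k
      _ = 4 * ‖F u‖ * (√(traceSq F u) * √(traceSq F u)) := by rw [abs_two]; ring
      _ = _ := by rw [Real.mul_self_sqrt hG]
  simp only [Fin.sum_univ_two]
  refine (abs_add_le _ _).trans ?_
  have h1 := abs_add_le (2 * (cubic F 0 0 0 u + cubic F 1 1 0 u)
      * cubic F m 0 0 u * inner ℝ (partialD 0 F u) (F u)) (2 * (cubic F 0 0 0 u + cubic F 1 1 0 u)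
      * cubic F m 0 1 u * inner ℝ (partialD 1 F u) (F u))
  have h2 := abs_add_le (2 * (cubic F 0 0 1 u + cubic F 1 1 1 u)
      * cubic F m 1 0 u * inner ℝ (partialD 0 F u) (F u)) (2 * (cubic F 0 0 1 u + cubic F 1 1 1 u)
      * cubic F m 1 1 u * inner ℝ (partialD 1 F u) (F u))
  linarith [hterm 0 0, hterm 0 1, hterm 1 0, hterm 1 1]

/-- If the mean curvature vanishes at a point then it vanishes nearby. -/
theorem traceSq_eq_zero (hF : IsFlatLagrangianShrinker F B) (hB : IsOpen B) (hc : Convex ℝ B)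
    {C : ℝ} (hC : ∀ v ∈ B, ‖F v‖ ≤ C) {p : RSpace 2} (hp : p ∈ B) (h0 : traceSq F p = 0)
    (hu : u ∈ B) : traceSq F u = 0 := by
  have hseg : ∀ t ∈ Set.Icc (0 : ℝ) 1, p + t • (u - p) ∈ B := fun t ht =>
    hc.add_smul_sub_mem hp hu ht
  have hC0 : 0 ≤ C := (norm_nonneg _).trans (hC p hp)
  have hG := hF.contDiffOn_traceSq hB
  have hd : ∀ t ∈ Set.Icc (0 : ℝ) 1, HasDerivAt (fun t : ℝ => traceSq F (p + t • (u - p)))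
      (fderiv ℝ (traceSq F) (p + t • (u - p)) (u - p)) t := fun t ht => by
    have h1 : HasDerivAt (fun t : ℝ => p + t • (u - p)) (u - p) t := by
      simpa using ((hasDerivAt_id t).smul_const (u - p)).const_add p
    exact (differentiableAt_of_contDiffOn hB hG (hseg t ht)).hasFDerivAt.comp_hasDerivAt t h1
  set K : ℝ := ∑ i, |(u - p) i| * (16 * C)
  -- Grönwall along the segment from p to u.
  have := eq_zero_of_abs_deriv_le_mul_abs_self_of_eq_zero_right
    (f := fun t : ℝ => traceSq F (p + t • (u - p))) (K := K) (a := 0) (b := 1)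
    (fun t ht => (hd t ht).continuousAt.continuousWithinAt)
    (fun t ht => (hd t ⟨ht.1, ht.2.le⟩).hasDerivWithinAt) (by simpa using h0)
    (fun t ht => by
      have hm := hseg t ⟨ht.1, ht.2.le⟩
      have hG0 : 0 ≤ traceSq F (p + t • (u - p)) := by unfold traceSq; positivity
      rw [fderiv_apply_eq_sum_partialD, Real.norm_of_nonneg hG0, Finset.sum_mul]
      refine (norm_sum_le _ _).trans (Finset.sum_le_sum fun i _ => ?_)
      rw [norm_smul, Real.norm_eq_abs, Real.norm_eq_abs, mul_assoc]
      gcongr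
      refine (hF.abs_partialD_traceSq_le hB hm i).trans ?_
      gcongr
      exact hC _ hm)
    1 (by simp)
  simpa using this

end IsFlatLagrangianShrinker

theorem eqOn_const_of_partialD_eq_zero {n : ℕ} {f : RSpace n → ℝ} {B : Set (RSpace n)}
    (hB : IsOpen B) (hc : Convex ℝ B) (hf : ContDiffOn ℝ ∞ f B)
    (h : ∀ u ∈ B, ∀ i, partialD i f u = 0) {u v : RSpace n} (hu : u ∈ B) (hv : v ∈ B) :
    f u = f v := by
  refine hB.is_const_of_fderiv_eq_zero hc.isPreconnected (hf.differentiableOn (by simp))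
    (fun w hw => ?_) hu hv
  ext x
  rw [fderiv_apply_eq_sum_partialD]
  simp [h w hw]

/-- The direction diagonalizing the cubic form. -/
theorem exists_angle {p q : ℝ} (h : p ^ 2 + q ^ 2 = 1) : ∃ c s : ℝ, c ^ 2 + s ^ 2 = 1 ∧
    p = (c ^ 2 - s ^ 2) ^ 2 - (2 * c * s) ^ 2 ∧ q = -2 * (c ^ 2 - s ^ 2) * (2 * c * s) := by
  set z : ℂ := ⟨p, q⟩
  have hz : ‖z‖ = 1 := by
    have : ‖z‖ ^ 2 = 1 := by
      rw [← Complex.normSq_eq_norm_sq, Complex.normSq_apply]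
      linarith
    nlinarith [norm_nonneg z]
  -- Rotating the coordinates through `a` multiplies the quotient τ/η by e^{4ia}: three factors come
  -- from τ and one from η. Minus a quarter of the argument therefore normalizes it to 1.
  set a : ℝ := -(z.arg / 4)
  have hp : p = Real.cos (2 * (2 * a)) := by
    have := Complex.norm_mul_cos_arg z
    rw [hz, one_mul] at this
    rw [show 2 * (2 * a) = -z.arg by simp only [a]; ring, Real.cos_neg, this]
  have hq : q = -Real.sin (2 * (2 * a)) := by
    have := Complex.norm_mul_sin_arg z
    rw [hz, one_mul] at this
    rw [show 2 * (2 * a) = -z.arg by simp only [a]; ring, Real.sin_neg, this, neg_neg]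
  refine ⟨Real.cos a, Real.sin a, Real.cos_sq_add_sin_sq a, ?_, ?_⟩
  · rw [hp, Real.cos_two_mul', Real.cos_two_mul', Real.sin_two_mul]
    ring
  · rw [hq, Real.sin_two_mul, Real.cos_two_mul', Real.sin_two_mul]
    ring

/-! ### The quotient is constant and the second fundamental form diagonalizes -/

namespace IsFlatLagrangianShrinker

variable {F : RSpace 2 → C2} {B : Set (RSpace 2)} {u : RSpace 2}

/-- Real part of the quotient of the traceless part of the cubic form by the conjugate of its
trace. -/
noncomputable def quotientRe (F : RSpace 2 → C2) (u : RSpace 2) : ℝ :=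
  ((cubic F 0 0 0 u - 3 * cubic F 1 1 0 u) * (cubic F 0 0 0 u + cubic F 1 1 0 u)
    + (cubic F 1 1 1 u - 3 * cubic F 0 0 1 u) * (cubic F 0 0 1 u + cubic F 1 1 1 u)) / traceSq F u

/-- Imaginary part of the quotient of the traceless part of the cubic form by the conjugate of its
trace. -/
noncomputable def quotientIm (F : RSpace 2 → C2) (u : RSpace 2) : ℝ :=
  ((cubic F 1 1 1 u - 3 * cubic F 0 0 1 u) * (cubic F 0 0 0 u + cubic F 1 1 0 u)
    - (cubic F 0 0 0 u - 3 * cubic F 1 1 0 u) * (cubic F 0 0 1 u + cubic F 1 1 1 u)) / traceSq F u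

theorem quotient_relations (hF : IsFlatLagrangianShrinker F B) (hB : IsOpen B) (hu : u ∈ B)
    (h0 : traceSq F u ≠ 0) :
    cubic F 0 0 0 u - 3 * cubic F 1 1 0 u
      = quotientRe F u * (cubic F 0 0 0 u + cubic F 1 1 0 u)
        - quotientIm F u * (cubic F 0 0 1 u + cubic F 1 1 1 u) ∧
    cubic F 1 1 1 u - 3 * cubic F 0 0 1 u
      = quotientRe F u * (cubic F 0 0 1 u + cubic F 1 1 1 u)
        + quotientIm F u * (cubic F 0 0 0 u + cubic F 1 1 0 u) ∧
    quotientRe F u ^ 2 + quotientIm F u ^ 2 = 1 := by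
  have hg := hF.cubic_gauss hB hu
  unfold quotientRe quotientIm
  have e : traceSq F u = (cubic F 0 0 0 u + cubic F 1 1 0 u) ^ 2
    + (cubic F 0 0 1 u + cubic F 1 1 1 u) ^ 2 := rfl
  set D := traceSq F u
  set a0 := cubic F 0 0 0 u
  set a1 := cubic F 0 0 1 u
  set a2 := cubic F 1 1 0 u
  set a3 := cubic F 1 1 1 u
  refine ⟨?_, ?_, ?_⟩
  · field_simp
    rw [e]
    ring
  · field_simp
    rw [e]
    ring
  · field_simp
    -- The Gauss equation in the form |τ|² = |η|².
    have e' : D = (a0 - 3 * a2) ^ 2 + (a3 - 3 * a1) ^ 2 := by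
      linear_combination e + 8 * hg
    rw [sq D]
    nth_rewrite 1 [e]
    rw [e']
    ring

theorem partialD_quotient (hF : IsFlatLagrangianShrinker F B) (hB : IsOpen B)
    (h0 : ∀ v ∈ B, traceSq F v ≠ 0) :
    ContDiffOn ℝ ∞ (quotientRe F) B ∧ ContDiffOn ℝ ∞ (quotientIm F) B ∧
      ∀ u ∈ B, ∀ i, partialD i (quotientRe F) u = 0 ∧ partialD i (quotientIm F) u = 0 := by
  have hcub := fun j k l => contDiffOn_cubic hB hF.1 j k l
  have hP : ContDiffOn ℝ ∞ (quotientRe F) B :=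
    (((((hcub 0 0 0).sub (contDiffOn_const.mul (hcub 1 1 0))).mul ((hcub 0 0 0).add (hcub 1 1 0))).add
      (((hcub 1 1 1).sub (contDiffOn_const.mul (hcub 0 0 1))).mul
        ((hcub 0 0 1).add (hcub 1 1 1)))).div (hF.contDiffOn_traceSq hB) h0)
  have hQ : ContDiffOn ℝ ∞ (quotientIm F) B :=
    (((((hcub 1 1 1).sub (contDiffOn_const.mul (hcub 0 0 1))).mul ((hcub 0 0 0).add (hcub 1 1 0))).sub
      (((hcub 0 0 0).sub (contDiffOn_const.mul (hcub 1 1 0))).mul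
        ((hcub 0 0 1).add (hcub 1 1 1)))).div (hF.contDiffOn_traceSq hB) h0)
  refine ⟨hP, hQ, fun u hu => ?_⟩
  have d := fun j k l => differentiableAt_of_contDiffOn hB (hcub j k l) hu
  have dP := differentiableAt_of_contDiffOn hB hP hu
  have dQ := differentiableAt_of_contDiffOn hB hQ hu
  have dt : ∀ l, DifferentiableAt ℝ (fun v => cubic F 0 0 l v + cubic F 1 1 l v) u :=
    fun l => (d 0 0 l).add (d 1 1 l)
  have hA : ∀ i, partialD i (cubic F 0 0 0) u - 3 * partialD i (cubic F 1 1 0) u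
      = partialD i (quotientRe F) u * (cubic F 0 0 0 u + cubic F 1 1 0 u)
        + quotientRe F u * (partialD i (cubic F 0 0 0) u + partialD i (cubic F 1 1 0) u)
        - (partialD i (quotientIm F) u * (cubic F 0 0 1 u + cubic F 1 1 1 u)
        + quotientIm F u * (partialD i (cubic F 0 0 1) u + partialD i (cubic F 1 1 1) u)) := by
    intro i
    have := partialD_congr (f := fun v => cubic F 0 0 0 v - 3 * cubic F 1 1 0 v)
      (g := fun v => quotientRe F v * (cubic F 0 0 0 v + cubic F 1 1 0 v)
        - quotientIm F v * (cubic F 0 0 1 v + cubic F 1 1 1 v)) hB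
      (fun v hv => (hF.quotient_relations hB hv (h0 v hv)).1) hu i
    rw [partialD_sub (d 0 0 0) ((d 1 1 0).const_mul 3),
      partialD_mul (differentiableAt_const _) (d 1 1 0), partialD_const,
      partialD_sub (dP.fun_mul (dt 0)) (dQ.fun_mul (dt 1)), partialD_mul dP (dt 0),
      partialD_mul dQ (dt 1), partialD_add (d 0 0 0) (d 1 1 0),
      partialD_add (d 0 0 1) (d 1 1 1)] at this
    linear_combination this
  have hA' : ∀ i, partialD i (cubic F 1 1 1) u - 3 * partialD i (cubic F 0 0 1) u
      = partialD i (quotientRe F) u * (cubic F 0 0 1 u + cubic F 1 1 1 u)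
        + quotientRe F u * (partialD i (cubic F 0 0 1) u + partialD i (cubic F 1 1 1) u)
        + (partialD i (quotientIm F) u * (cubic F 0 0 0 u + cubic F 1 1 0 u)
        + quotientIm F u * (partialD i (cubic F 0 0 0) u + partialD i (cubic F 1 1 0) u)) := by
    intro i
    have := partialD_congr (f := fun v => cubic F 1 1 1 v - 3 * cubic F 0 0 1 v)
      (g := fun v => quotientRe F v * (cubic F 0 0 1 v + cubic F 1 1 1 v)
        + quotientIm F v * (cubic F 0 0 0 v + cubic F 1 1 0 v)) hB
      (fun v hv => (hF.quotient_relations hB hv (h0 v hv)).2.1) hu i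
    rw [partialD_sub (d 1 1 1) ((d 0 0 1).const_mul 3),
      partialD_mul (differentiableAt_const _) (d 0 0 1), partialD_const,
      partialD_add (dP.fun_mul (dt 1)) (dQ.fun_mul (dt 0)), partialD_mul dP (dt 1),
      partialD_mul dQ (dt 0), partialD_add (d 0 0 0) (d 1 1 0),
      partialD_add (d 0 0 1) (d 1 1 1)] at this
    linear_combination this
  have hN : ∀ i, quotientRe F u * partialD i (quotientRe F) u
      + quotientIm F u * partialD i (quotientIm F) u = 0 := by
    intro i
    have := partialD_congr (f := fun v => quotientRe F v * quotientRe F v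
        + quotientIm F v * quotientIm F v) (g := fun _ => 1) hB
      (fun v hv => by simpa [sq] using (hF.quotient_relations hB hv (h0 v hv)).2.2) hu i
    rw [partialD_const, partialD_add (dP.fun_mul dP) (dQ.fun_mul dQ), partialD_mul dP dP,
      partialD_mul dQ dQ] at this
    linear_combination (1 / 2) * this
  obtain ⟨r1, r2, r3⟩ := hF.quotient_relations hB hu (h0 u hu)
  have hrel := fun v (hv : v ∈ B) => hF.cubic_relations hB hv
  -- the partial derivatives of the cubic form are totally symmetric
  have c1 : partialD 1 (cubic F 0 0 0) u = partialD 0 (cubic F 0 0 1) u := by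
    rw [hF.codazzi hB hu 1 0 0 0]
    exact partialD_congr hB (fun v hv => (hrel v hv).2.1) hu 0
  have c2 : partialD 1 (cubic F 0 0 1) u = partialD 0 (cubic F 1 1 0) u := by
    rw [hF.codazzi hB hu 1 0 0 1]
    exact partialD_congr hB (fun v hv => (hrel v hv).2.2.2) hu 0
  have c3 : partialD 1 (cubic F 1 1 0) u = partialD 0 (cubic F 1 1 1) u := by
    rw [← hF.codazzi hB hu 1 0 1 1]
    exact (partialD_congr hB (fun v hv => (hrel v hv).2.2.1) hu 1).symm
  have t := fun m l => hF.partialD_trace_cubic hB hu m l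
  simp only [Fin.sum_univ_two] at t
  obtain ⟨q1, q2, q3, q4⟩ := hrel u hu
  have t0 := t 0 0
  have t1 := t 0 1
  have t2 := t 1 1
  rw [q1, q3] at t1
  have fin := differential_quotient_eq_zero (h0 u hu) r1 r2 r3 t0 t1 (c2 ▸ t2)
    (hA 0) (by have := hA 1; rw [c1, c2, c3] at this; exact this)
    (hA' 0) (by have := hA' 1; rw [c1, c2, c3] at this; linear_combination this)
    (hN 0) (hN 1)
  obtain ⟨z1, z2, z3, z4⟩ := fin
  intro i
  fin_cases i
  · exact ⟨z1, z3⟩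
  · exact ⟨z2, z4⟩

/-- The flat coordinates can be rotated so that the second fundamental form is diagonal on a
neighbourhood. -/
theorem exists_diagonal_direction (hF : IsFlatLagrangianShrinker F B) (hB : IsOpen B)
    {p : RSpace 2} (hp : p ∈ B) : ∃ c s : ℝ, c ^ 2 + s ^ 2 = 1 ∧ ∃ B' ⊆ B, IsOpen B' ∧ p ∈ B' ∧
      ∀ u ∈ B', (c * s) • (partialD 1 (partialD 1 F) u - partialD 0 (partialD 0 F) u)
        + (c ^ 2 - s ^ 2) • partialD 0 (partialD 1 F) u = 0 := by
  by_cases h0 : traceSq F p = 0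
  · have hcont : ContinuousAt (fun v => ‖F v‖) p :=
      (differentiableAt_of_contDiffOn hB hF.1 hp).continuousAt.norm
    have hev : ∀ᶠ v in nhds p, v ∈ B ∧ ‖F v‖ ≤ ‖F p‖ + 1 :=
      (hB.eventually_mem hp).and ((hcont.eventually_lt_const (lt_add_one _)).mono fun _ h => h.le)
    obtain ⟨r, hr, hball⟩ := Metric.eventually_nhds_iff_ball.mp hev
    have hsub : Metric.ball p r ⊆ B := fun v hv => (hball v hv).1
    refine ⟨1, 0, by norm_num, Metric.ball p r, hsub, Metric.isOpen_ball,
      Metric.mem_ball_self hr, fun u hu => ?_⟩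
    -- Here the whole second fundamental form vanishes near p, so no rotation is needed.
    have hz := (hF.mono hsub).traceSq_eq_zero Metric.isOpen_ball (convex_ball p r)
      (fun v hv => (hball v hv).2) (Metric.mem_ball_self hr) h0 hu
    have hcz : ∀ j k l, cubic F j k l u = 0 := fun j k l => by
      have := hF.sq_cubic_le hB (hsub hu) j k l
      rw [hz] at this
      nlinarith [sq_nonneg (cubic F j k l u)]
    rw [hF.second_eq_sum hB (hsub hu) 0 1]
    simp [hcz]
  · have hcont : ContinuousAt (traceSq F) p :=
      (differentiableAt_of_contDiffOn hB (hF.contDiffOn_traceSq hB) hp).continuousAt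
    have hev : ∀ᶠ v in nhds p, v ∈ B ∧ traceSq F v ≠ 0 :=
      (hB.eventually_mem hp).and (hcont.eventually_ne h0)
    obtain ⟨r, hr, hball⟩ := Metric.eventually_nhds_iff_ball.mp hev
    have hsub : Metric.ball p r ⊆ B := fun v hv => (hball v hv).1
    obtain ⟨hP, hQ, hPQ⟩ := (hF.mono hsub).partialD_quotient Metric.isOpen_ball
      (fun v hv => (hball v hv).2)
    have hpm := Metric.mem_ball_self (x := p) hr
    obtain ⟨c, s, hcs, hp1, hq1⟩ := exists_angle (hF.quotient_relations hB hp h0).2.2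
    refine ⟨c, s, hcs, Metric.ball p r, hsub, Metric.isOpen_ball, hpm, fun u hu => ?_⟩
    rw [← eqOn_const_of_partialD_eq_zero Metric.isOpen_ball (convex_ball p r) hP
      (fun v hv i => (hPQ v hv i).1) hu hpm] at hp1
    rw [← eqOn_const_of_partialD_eq_zero Metric.isOpen_ball (convex_ball p r) hQ
      (fun v hv i => (hPQ v hv i).2) hu hpm] at hq1
    obtain ⟨r1, r2, -⟩ := hF.quotient_relations hB (hsub hu) (hball u hu).2
    obtain ⟨q1, -, q3, -⟩ := hF.cubic_relations hB (hsub hu)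
    rw [hF.second_eq_sum hB (hsub hu) 0 1, hF.second_eq_sum hB (hsub hu) 0 0,
      hF.second_eq_sum hB (hsub hu) 1 1]
    simp only [Fin.sum_univ_two, q1, q3]
    have h2 : (c ^ 2 - s ^ 2) ^ 2 + (2 * c * s) ^ 2 = 1 := by
      linear_combination (c ^ 2 + s ^ 2 + 1) * hcs
    rw [hp1, hq1] at r1 r2
    generalize cubic F 0 0 0 u = a0 at *
    generalize cubic F 0 0 1 u = a1 at *
    generalize cubic F 1 1 0 u = a2 at *
    generalize cubic F 1 1 1 u = a3 at *
    generalize partialD 0 F u = X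
    generalize partialD 1 F u = Y
    -- `w1` and `w2` are the coefficients of the rotated mixed derivative along iX and iY. They
    -- vanish because the angle (c, s) was chosen to turn the constant quotient into 1.
    have w1 : c * s * (a2 - a0) + (c ^ 2 - s ^ 2) * a1 = 0 := by
      linear_combination (-1 / 4) * (2 * c * s) * r1 + (-1 / 4) * (c ^ 2 - s ^ 2) * r2
        + (-1 / 4) * ((c ^ 2 - s ^ 2) * (a1 + a3) - (2 * c * s) * (a0 + a2)) * h2
    have w2 : c * s * (a3 - a1) + (c ^ 2 - s ^ 2) * a2 = 0 := by
      linear_combination (-1 / 4) * (c ^ 2 - s ^ 2) * r1 + (1 / 4) * (2 * c * s) * r2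
        + (-1 / 4) * ((c ^ 2 - s ^ 2) * (a0 + a2) + (2 * c * s) * (a1 + a3)) * h2
    have : (c * s * (a2 - a0) + (c ^ 2 - s ^ 2) * a1) • Complex.I • X
        + (c * s * (a3 - a1) + (c ^ 2 - s ^ 2) * a2) • Complex.I • Y = 0 := by
      rw [w1, w2]
      simp
    rw [← this]
    module

end IsFlatLagrangianShrinker

/-! ### Restriction to coordinate lines -/

section Lines

/-- A function with `∂ₖ f = 0` on a convex open set is constant along the `k`-th direction. -/
theorem eq_of_partialD_eq_zero {n : ℕ} {E : Type*} [NormedAddCommGroup E] [NormedSpace ℝ E]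
    {f : RSpace n → E} {B : Set (RSpace n)} (hB : IsOpen B) (hc : Convex ℝ B)
    (hf : ContDiffOn ℝ ∞ f B) {k : Fin n} (hk : ∀ w ∈ B, partialD k f w = 0)
    {u v : RSpace n} (hu : u ∈ B) (hv : v ∈ B) (huv : ∀ i, i ≠ k → u i = v i) : f v = f u := by
  have hseg : ∀ t ∈ Set.Icc (0 : ℝ) 1, u + t • (v - u) ∈ B := fun t ht =>
    hc.add_smul_sub_mem hu hv ht
  have hd : ∀ t ∈ Set.Icc (0 : ℝ) 1, HasDerivAt (fun t : ℝ => f (u + t • (v - u))) 0 t := by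
    intro t ht
    have h1 : HasDerivAt (fun t : ℝ => u + t • (v - u)) (v - u) t := by
      simpa using ((hasDerivAt_id t).smul_const (v - u)).const_add u
    refine ((differentiableAt_of_contDiffOn hB hf (hseg t ht)).hasFDerivAt.comp_hasDerivAt t
      h1).congr_deriv ?_
    rw [fderiv_apply_eq_sum_partialD]
    refine Finset.sum_eq_zero fun i _ => ?_
    by_cases hi : i = k
    · rw [hi, hk _ (hseg t ht), smul_zero]
    · simp [huv i hi]
  have := constant_of_has_deriv_right_zero (fun t ht => (hd t ht).continuousAt.continuousWithinAt)
    (fun t ht => (hd t ⟨ht.1, ht.2.le⟩).hasDerivWithinAt) 1 (by simp)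
  simpa using this

/-- The point with `k`-th coordinate `s` on the coordinate line through `p`. -/
noncomputable def coordLine {n : ℕ} (p : RSpace n) (k : Fin n) (s : ℝ) : RSpace n :=
  p + (s - p k) • EuclideanSpace.single k 1

variable {n : ℕ} {p : RSpace n} {k : Fin n}

theorem coordLine_apply_self (s : ℝ) : coordLine p k s k = s := by
  simp [coordLine]

theorem coordLine_apply_of_ne {i : Fin n} (hi : i ≠ k) (s : ℝ) : coordLine p k s i = p i := by
  simp [coordLine, hi]

theorem coordLine_mem_ball {r s : ℝ} (h : |s - p k| < r) :
    coordLine p k s ∈ Metric.ball p r := by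
  simpa [coordLine, Metric.mem_ball, dist_eq_norm, norm_smul] using h

theorem contDiff_coordLine : ContDiff ℝ ∞ (coordLine p k) :=
  contDiff_const.add ((contDiff_id.sub contDiff_const).smul contDiff_const)

theorem hasDerivAt_comp_coordLine {E : Type*} [NormedAddCommGroup E] [NormedSpace ℝ E]
    {f : RSpace n → E} {s : ℝ} (hf : DifferentiableAt ℝ f (coordLine p k s)) :
    HasDerivAt (fun s => f (coordLine p k s)) (partialD k f (coordLine p k s)) s := by
  have h1 : HasDerivAt (coordLine p k) (EuclideanSpace.single k 1) s := by
    have := (((hasDerivAt_id s).sub_const (p k)).smul_const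
      (EuclideanSpace.single k (1 : ℝ))).const_add p
    simp only [one_smul] at this
    exact this
  exact hf.hasFDerivAt.comp_hasDerivAt s h1

end Lines

/-! ### Rotation of flat coordinates -/

section Rotation

/-- Rotation of the plane. -/
noncomputable def rotation (c s : ℝ) (h : c ^ 2 + s ^ 2 = 1) : RSpace 2 ≃L[ℝ] RSpace 2 :=
  LinearEquiv.toContinuousLinearEquiv
    { toFun := fun v => !₂[c * v 0 - s * v 1, s * v 0 + c * v 1]
      invFun := fun v => !₂[c * v 0 + s * v 1, -s * v 0 + c * v 1]
      map_add' := fun v w => by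
        ext i
        fin_cases i <;> simp <;> ring
      map_smul' := fun a v => by
        ext i
        fin_cases i <;> simp <;> ring
      left_inv := fun v => by
        ext i
        fin_cases i
        · simp
          linear_combination v 0 * h
        · simp
          linear_combination v 1 * h
      right_inv := fun v => by
        ext i
        fin_cases i
        · simp
          linear_combination v 0 * h
        · simp
          linear_combination v 1 * h }

variable {c s : ℝ} (h : c ^ 2 + s ^ 2 = 1)

theorem rotation_single_zero : rotation c s h (EuclideanSpace.single 0 1)
    = c • EuclideanSpace.single 0 1 + s • EuclideanSpace.single 1 1 := by
  ext i
  fin_cases i <;> simp [rotation]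

theorem rotation_single_one : rotation c s h (EuclideanSpace.single 1 1)
    = -s • EuclideanSpace.single 0 1 + c • EuclideanSpace.single 1 1 := by
  ext i
  fin_cases i <;> simp [rotation]

variable {E : Type*} [NormedAddCommGroup E] [NormedSpace ℝ E] {f : RSpace 2 → E} {u : RSpace 2}

theorem partialD_comp_rotation (hf : DifferentiableAt ℝ f (rotation c s h u)) :
    partialD 0 (fun v => f (rotation c s h v)) u
        = c • partialD 0 f (rotation c s h u) + s • partialD 1 f (rotation c s h u) ∧
    partialD 1 (fun v => f (rotation c s h v)) u
        = -s • partialD 0 f (rotation c s h u) + c • partialD 1 f (rotation c s h u) := by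
  have h1 := (hf.hasFDerivAt.comp u (rotation c s h).hasFDerivAt).fderiv
  unfold partialD
  change fderiv ℝ (f ∘ rotation c s h) u _ = _ ∧ fderiv ℝ (f ∘ rotation c s h) u _ = _
  rw [h1]
  simp [rotation_single_zero, rotation_single_one]

theorem IsFlatLagrangianShrinker.comp_rotation {F : RSpace 2 → C2} {B : Set (RSpace 2)}
    (hB : IsOpen B) (hF : IsFlatLagrangianShrinker F B) :
    IsFlatLagrangianShrinker (fun v => F (rotation c s h v)) (rotation c s h ⁻¹' B) ∧
    ∀ u ∈ rotation c s h ⁻¹' B, partialD 0 (partialD 1 fun v => F (rotation c s h v)) u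
      = (c * s) • (partialD 1 (partialD 1 F) (rotation c s h u)
          - partialD 0 (partialD 0 F) (rotation c s h u))
        + (c ^ 2 - s ^ 2) • partialD 0 (partialD 1 F) (rotation c s h u) := by
  have hB' : IsOpen (rotation c s h ⁻¹' B) := hB.preimage (rotation c s h).continuous
  have d0 : ∀ u ∈ rotation c s h ⁻¹' B, DifferentiableAt ℝ F (rotation c s h u) := fun u hu =>
    differentiableAt_of_contDiffOn hB hF.1 hu
  have d1 : ∀ i, ∀ u ∈ rotation c s h ⁻¹' B,
      DifferentiableAt ℝ (partialD i F) (rotation c s h u) := fun i u hu =>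
    differentiableAt_of_contDiffOn hB (contDiffOn_partialD hB hF.1 i) hu
  have d2 : ∀ i, ∀ u ∈ rotation c s h ⁻¹' B,
      DifferentiableAt ℝ (fun v => partialD i F (rotation c s h v)) u := fun i u hu =>
    (d1 i u hu).comp u (rotation c s h).differentiableAt
  have s0 : ∀ i, ∀ u ∈ rotation c s h ⁻¹' B,
      partialD i (partialD 0 fun v => F (rotation c s h v)) u
        = c • partialD i (fun v => partialD 0 F (rotation c s h v)) u
          + s • partialD i (fun v => partialD 1 F (rotation c s h v)) u := fun i u hu => by
    rw [partialD_congr hB' (fun v hv => (partialD_comp_rotation h (d0 v hv)).1) hu,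
      partialD_add ((d2 0 u hu).fun_const_smul c) ((d2 1 u hu).fun_const_smul s),
      partialD_smul (differentiableAt_const c) (d2 0 u hu),
      partialD_smul (differentiableAt_const s) (d2 1 u hu)]
    simp [partialD_const]
  have s1 : ∀ i, ∀ u ∈ rotation c s h ⁻¹' B,
      partialD i (partialD 1 fun v => F (rotation c s h v)) u
        = -s • partialD i (fun v => partialD 0 F (rotation c s h v)) u
          + c • partialD i (fun v => partialD 1 F (rotation c s h v)) u := fun i u hu => by
    rw [partialD_congr hB' (fun v hv => (partialD_comp_rotation h (d0 v hv)).2) hu,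
      partialD_add ((d2 0 u hu).fun_const_smul (-s)) ((d2 1 u hu).fun_const_smul c),
      partialD_smul (differentiableAt_const (-s)) (d2 0 u hu),
      partialD_smul (differentiableAt_const c) (d2 1 u hu)]
    simp [partialD_const]
  refine ⟨⟨?_, fun u hu => ?_, fun u hu => ?_⟩, fun u hu => ?_⟩
  · exact hF.1.comp (rotation c s h).contDiff.contDiffOn (Set.mapsTo_preimage _ _)
  · obtain ⟨h1, h2⟩ := orthonormal_complex_iff.mp (hF.orthonormal _ hu)
    rw [orthonormal_complex_iff]
    obtain ⟨r0, r1⟩ := partialD_comp_rotation h (d0 u hu)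
    constructor <;> intro j k <;> fin_cases j <;> fin_cases k <;>
      simp only [Fin.zero_eta, Fin.mk_one, r0, r1, smul_add, smul_comm Complex.I (_ : ℝ),
        inner_add_left, inner_add_right, real_inner_smul_left, real_inner_smul_right, h1, h2] <;>
      simp <;> first | linear_combination h | ring
  · obtain ⟨r0, r1⟩ := partialD_comp_rotation h (d0 u hu)
    have hs := hF.shrinker _ hu
    rw [s0 0 u hu, s1 1 u hu, (partialD_comp_rotation h (d1 0 u hu)).1,
      (partialD_comp_rotation h (d1 1 u hu)).1, (partialD_comp_rotation h (d1 0 u hu)).2,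
      (partialD_comp_rotation h (d1 1 u hu)).2, Fin.sum_univ_two, r0, r1]
    rw [Fin.sum_univ_two] at hs
    simp only [inner_add_right, real_inner_smul_right]
    rw [partialD_comm hB hF.1 hu 1 0]
    generalize partialD 0 (partialD 0 F) (rotation c s h u) = A at *
    generalize partialD 1 (partialD 1 F) (rotation c s h u) = D at *
    generalize partialD 0 (partialD 1 F) (rotation c s h u) = M at *
    generalize partialD 0 F (rotation c s h u) = X at *
    generalize partialD 1 F (rotation c s h u) = Y at *
    generalize F (rotation c s h u) = Z at *
    generalize (inner ℝ Z X : ℝ) = x at *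
    generalize (inner ℝ Z Y : ℝ) = y at *
    have e1 : A + D = -(Z - (x • X + y • Y)) := hs
    have e2 : c • (c • A + s • M) + s • (c • M + s • D)
        + (-s • (-s • A + c • M) + c • (-s • M + c • D)) = (c ^ 2 + s ^ 2) • (A + D) := by
      module
    have e3 : (c * x + s * y) • (c • X + s • Y) + (-s * x + c * y) • (-s • X + c • Y)
        = (c ^ 2 + s ^ 2) • (x • X + y • Y) := by
      module
    rw [e2, e3, h, one_smul, one_smul, e1]
  · rw [s1 0 u hu, (partialD_comp_rotation h (d1 0 u hu)).1,
      (partialD_comp_rotation h (d1 1 u hu)).1, partialD_comm hB hF.1 hu 1 0]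
    module

end Rotation

/-! ### Splitting into two planar curves when the mixed derivative vanishes -/

namespace IsFlatLagrangianShrinker

variable {F : RSpace 2 → C2} {p : RSpace 2} {r : ℝ}

/-- When ∂₀∂₁F = 0 each ∂ᵢF depends on the i-th variable alone. The Hermitian component of F along
∂ₖF(p) is then a function of `u k` only, and it inherits unit speed and the shrinker equation from
F. -/
theorem exists_component (hr : 0 < r) (hF : IsFlatLagrangianShrinker F (Metric.ball p r))
    (hm : ∀ u ∈ Metric.ball p r, partialD 0 (partialD 1 F) u = 0) (k : Fin 2) :
    ∃ Γ : ℝ → ℂ, IsAbreschLangerCurve Γ ∧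
      ∀ᶠ u in nhds p, inner ℂ (partialD k F p) (F u) = Γ (u k) := by
  obtain ⟨k', hk⟩ : ∃ k' : Fin 2, k' ≠ k := exists_ne k
  have hB : IsOpen (Metric.ball p r) := Metric.isOpen_ball
  have hc := convex_ball p r
  have hp : p ∈ Metric.ball p r := Metric.mem_ball_self hr
  have hmix : ∀ u ∈ Metric.ball p r, ∀ i j : Fin 2, i ≠ j → partialD i (partialD j F) u = 0 := by
    intro u hu i j hij
    fin_cases i <;> fin_cases j
    · exact absurd rfl hij
    · exact hm u hu
    · exact (partialD_comm hB hF.1 hu 1 0).trans (hm u hu)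
    · exact absurd rfl hij
  have hne : ∀ i : Fin 2, i ≠ k → i = k' := by
    intro i hi
    fin_cases i <;> fin_cases k <;> fin_cases k' <;> simp_all
  have hne' : ∀ i : Fin 2, i ≠ k' → i = k := by
    intro i hi
    by_contra h
    exact hi (hne i h)
  have hs1 := fun i => contDiffOn_partialD hB hF.1 i
  have hline : ∀ i : Fin 2, ∀ u ∈ Metric.ball p r, coordLine p i (u i) ∈ Metric.ball p r := by
    intro i u hu
    refine coordLine_mem_ball (lt_of_le_of_lt ?_ (mem_ball_iff_norm.mp hu))
    exact PiLp.norm_apply_le (u - p) i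
  set L : C2 →L[ℝ] ℂ := (innerSL ℂ (partialD k F p)).restrictScalars ℝ with hL
  have hLa : ∀ v, L v = inner ℂ (partialD k F p) v := fun v => rfl
  -- Sliding u in direction k to the k'-line through p leaves ∂ₖ'F unchanged, and on that line ∂ₖF
  -- is still ∂ₖF(p); so unitarity at the slid point gives orthogonality to ∂ₖF(p).
  have hLk' : ∀ u ∈ Metric.ball p r, L (partialD k' F u) = 0 := by
    intro u hu
    have hq := hline k' u hu
    have e1 : partialD k' F u = partialD k' F (coordLine p k' (u k')) :=
      eq_of_partialD_eq_zero hB hc (hs1 k') (k := k) (fun w hw => hmix w hw k k' hk.symm) hq hu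
        (fun i hi => by rw [hne i hi, coordLine_apply_self])
    have e2 : partialD k F (coordLine p k' (u k')) = partialD k F p :=
      eq_of_partialD_eq_zero hB hc (hs1 k) (k := k') (fun w hw => hmix w hw k' k hk) hp hq
        (fun i hi => (coordLine_apply_of_ne hi _).symm)
    rw [hLa, e1, ← e2]
    exact (hF.orthonormal _ hq).2 hk.symm
  have hLF : ∀ u ∈ Metric.ball p r, L (F u) = L (F (coordLine p k (u k))) := fun u hu =>
    eq_of_partialD_eq_zero (f := fun v => L (F v)) hB hc (L.contDiff.comp_contDiffOn hF.1)
      (k := k') (fun w hw => by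
        rw [partialD_clm L (differentiableAt_of_contDiffOn hB hF.1 hw), hLk' w hw])
      (hline k u hu) hu (fun i hi => by rw [hne' i hi, coordLine_apply_self])
  have hLk'' : ∀ u ∈ Metric.ball p r, L (partialD k' (partialD k' F) u) = 0 := by
    intro u hu
    rw [← partialD_clm L (differentiableAt_of_contDiffOn hB (hs1 k') hu),
      partialD_congr hB hLk' hu, partialD_const]
  -- Parseval with respect to the frame at `p`
  have hinner : ∀ v w : C2, inner ℂ v w = inner ℂ (L v) (L w)
        + inner ℂ (inner ℂ (partialD k' F p) v) (inner ℂ (partialD k' F p) w) := by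
    intro v w
    have hon := hF.orthonormal p hp
    let b := basisOfOrthonormalOfCardEqFinrank hon (by simp)
    have hb : ⇑b = fun j => partialD j F p :=
      coe_basisOfOrthonormalOfCardEqFinrank hon (by simp)
    let o : OrthonormalBasis (Fin 2) ℂ C2 := b.toOrthonormalBasis (by rw [hb]; exact hon)
    have ho : ⇑o = fun j => partialD j F p := by rw [Module.Basis.coe_toOrthonormalBasis, hb]
    rw [← o.sum_inner_mul_inner v w, ho,
      Fintype.sum_eq_add k k' hk.symm (fun i hi => absurd (hne i hi.1) hi.2)]
    simp [hLa, mul_comm]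
  have hkline : ∀ s ∈ Metric.ball (p k) r, coordLine p k s ∈ Metric.ball p r := fun s hs =>
    coordLine_mem_ball (by simpa [Real.dist_eq] using hs)
  -- On the k-line ∂ₖF has no component along ∂ₖ'F(p), so by `hinner` L preserves its norm and its
  -- inner products with other vectors.
  have hk'0 : ∀ s ∈ Metric.ball (p k) r,
      inner ℂ (partialD k' F p) (partialD k F (coordLine p k s)) = 0 := by
    intro s hs
    have e2 : partialD k' F (coordLine p k s) = partialD k' F p :=
      eq_of_partialD_eq_zero hB hc (hs1 k') (k := k) (fun w hw => hmix w hw k k' hk.symm) hp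
        (hkline s hs) (fun i hi => (coordLine_apply_of_ne hi _).symm)
    rw [← e2]
    exact (hF.orthonormal _ (hkline s hs)).2 hk
  have hγ1 : ∀ s ∈ Metric.ball (p k) r, HasDerivAt (fun s => L (F (coordLine p k s)))
      (L (partialD k F (coordLine p k s))) s := fun s hs =>
    L.hasFDerivAt.comp_hasDerivAt s (hasDerivAt_comp_coordLine
      (differentiableAt_of_contDiffOn hB hF.1 (hkline s hs)))
  have hγ2 : ∀ s ∈ Metric.ball (p k) r, deriv (deriv fun s => L (F (coordLine p k s))) s
      = L (partialD k (partialD k F) (coordLine p k s)) := fun s hs => by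
    have e : deriv (fun s => L (F (coordLine p k s)))
        =ᶠ[nhds s] fun s => L (partialD k F (coordLine p k s)) :=
      Filter.eventuallyEq_of_mem (Metric.isOpen_ball.mem_nhds hs) fun t ht => (hγ1 t ht).deriv
    rw [e.deriv_eq]
    exact (L.hasFDerivAt.comp_hasDerivAt s (hasDerivAt_comp_coordLine
      (differentiableAt_of_contDiffOn hB (hs1 k) (hkline s hs)))).deriv
  obtain ⟨Γ, hΓ, hΓe⟩ := exists_isAbreschLangerCurve_eventuallyEq
    (γ := fun s => L (F (coordLine p k s))) (S := Metric.ball (p k) r) (s₀ := p k)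
    Metric.isOpen_ball (Metric.mem_ball_self hr)
    (L.contDiff.comp_contDiffOn (hF.1.comp contDiff_coordLine.contDiffOn hkline))
    (fun s hs => by
      rw [(hγ1 s hs).deriv]
      have h1 := hinner (partialD k F (coordLine p k s)) (partialD k F (coordLine p k s))
      rw [hk'0 s hs, inner_zero_left, add_zero, inner_self_eq_norm_sq_to_K,
        inner_self_eq_norm_sq_to_K, (hF.orthonormal _ (hkline s hs)).1 k] at h1
      have h2 : ‖L (partialD k F (coordLine p k s))‖ ^ 2 = 1 := by
        have : ((‖L (partialD k F (coordLine p k s))‖ ^ 2 : ℝ) : ℂ) = ((1 : ℝ) : ℂ) := by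
          push_cast
          simpa using h1.symm
        exact_mod_cast this
      nlinarith [norm_nonneg (L (partialD k F (coordLine p k s)))])
    (fun s hs => by
      rw [hγ2 s hs, (hγ1 s hs).deriv]
      have hq := hkline s hs
      have h1 := congrArg L (hF.shrinker _ hq)
      rw [← Fin.sum_univ_two (fun i => partialD i (partialD i F) (coordLine p k s)),
        Fintype.sum_eq_add k k' hk.symm (fun i hi => absurd (hne i hi.1) hi.2),
        Fintype.sum_eq_add k k' hk.symm (fun i hi => absurd (hne i hi.1) hi.2)] at h1
      simp only [map_add, map_neg, map_sub, map_smul, hLk'' _ hq, hLk' _ hq, add_zero,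
        smul_zero] at h1
      rw [h1, inner_real_eq_re, hinner _ _, hk'0 s hs, inner_zero_right,
        add_zero]
      rfl)
  refine ⟨Γ, hΓ, ?_⟩
  have hcont : Filter.Tendsto (fun u : RSpace 2 => u k) (nhds p) (nhds (p k)) :=
    (EuclideanSpace.proj k : RSpace 2 →L[ℝ] ℝ).continuous.tendsto p
  filter_upwards [hcont.eventually hΓe, hB.mem_nhds hp] with u hu hu'
  rw [hu, ← hLF u hu', hLa]

theorem exists_product (hr : 0 < r) (hF : IsFlatLagrangianShrinker F (Metric.ball p r))
    (hm : ∀ u ∈ Metric.ball p r, partialD 0 (partialD 1 F) u = 0) :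
    ∃ γ₁ γ₂ : ℝ → ℂ, IsAbreschLangerCurve γ₁ ∧ IsAbreschLangerCurve γ₂ ∧
      ∃ T : C2 ≃ₗᵢ[ℂ] C2, ∀ᶠ u in nhds p, F u = T !₂[γ₁ (u 0), γ₂ (u 1)] := by
  obtain ⟨γ₁, h1, e1⟩ := hF.exists_component hr hm 0
  obtain ⟨γ₂, h2, e2⟩ := hF.exists_component hr hm 1
  have hon := hF.orthonormal p (Metric.mem_ball_self hr)
  let b := basisOfOrthonormalOfCardEqFinrank hon (by simp)
  have hb : ⇑b = fun j => partialD j F p :=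
    coe_basisOfOrthonormalOfCardEqFinrank hon (by simp)
  let o : OrthonormalBasis (Fin 2) ℂ C2 := b.toOrthonormalBasis (by rw [hb]; exact hon)
  have ho : ⇑o = fun j => partialD j F p := by rw [Module.Basis.coe_toOrthonormalBasis, hb]
  refine ⟨γ₁, γ₂, h1, h2, o.repr.symm, ?_⟩
  filter_upwards [e1, e2] with u hu1 hu2
  rw [LinearIsometryEquiv.eq_symm_apply]
  ext i
  rw [o.repr_apply_apply, ho]
  fin_cases i
  · exact hu1
  · exact hu2

end IsFlatLagrangianShrinker

/-! ### Christoffel symbols and the Gauss equation in an arbitrary chart -/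

section GaussEquation

variable {E : Type*} [NormedAddCommGroup E] [InnerProductSpace ℝ E]
  {f : RSpace 2 → E} {B : Set (RSpace 2)} {u : RSpace 2}

theorem linearIndependent_partialD (h : Function.Injective (fderiv ℝ f u)) :
    LinearIndependent ℝ fun i => partialD i f u := by
  rw [Fintype.linearIndependent_iff]
  intro a ha i
  have h1 : fderiv ℝ f u (WithLp.toLp 2 a) = 0 := by
    rw [fderiv_apply_eq_sum_partialD]
    exact ha
  have h2 := h (h1.trans (map_zero _).symm)
  simpa using congrArg (fun v : RSpace 2 => v i) h2

theorem isUnit_det_metric (h : Function.Injective (fderiv ℝ f u)) :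
    IsUnit (metric f u).det :=
  (Matrix.posDef_gram_of_linearIndependent (linearIndependent_partialD h)).det_pos.ne'.isUnit

theorem contDiffOn_metric (hB : IsOpen B) (hf : ContDiffOn ℝ ∞ f B) (i j : Fin 2) :
    ContDiffOn ℝ ∞ (fun v => metric f v i j) B :=
  (contDiffOn_partialD hB hf i).inner ℝ (contDiffOn_partialD hB hf j)

theorem contDiffOn_inv_metric (hB : IsOpen B) (hf : ContDiffOn ℝ ∞ f B)
    (hi : ∀ v ∈ B, Function.Injective (fderiv ℝ f v)) (i j : Fin 2) :
    ContDiffOn ℝ ∞ (fun v => (metric f v)⁻¹ i j) B := by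
  have hg := contDiffOn_metric hB hf
  have hdet : ContDiffOn ℝ ∞ (fun v => (metric f v).det) B := by
    simp only [Matrix.det_fin_two]
    exact ((hg 0 0).mul (hg 1 1)).sub ((hg 0 1).mul (hg 1 0))
  have hadj : ContDiffOn ℝ ∞ (fun v => (metric f v).adjugate i j) B := by
    simp only [Matrix.adjugate_fin_two]
    fin_cases i <;> fin_cases j
    · exact hg 1 1
    · exact (hg 0 1).neg
    · exact (hg 1 0).neg
    · exact hg 0 0
  simp only [Matrix.inv_def, Ring.inverse_eq_inv', Matrix.smul_apply, smul_eq_mul]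
  exact (hdet.inv fun v hv => (isUnit_det_metric (hi v hv)).ne_zero).mul hadj

theorem partialD_metric (hB : IsOpen B) (hf : ContDiffOn ℝ ∞ f B) (hu : u ∈ B) (i j k : Fin 2) :
    partialD i (fun v => metric f v j k) u
      = inner ℝ (partialD j f u) (partialD i (partialD k f) u)
        + inner ℝ (partialD i (partialD j f) u) (partialD k f u) :=
  partialD_inner (differentiableAt_of_contDiffOn hB (contDiffOn_partialD hB hf j) hu)
    (differentiableAt_of_contDiffOn hB (contDiffOn_partialD hB hf k) hu) i

/-- The product rule turns the three metric derivatives into six terms; by symmetry of second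
derivatives four cancel and two coincide. -/
theorem christoffel_eq (hB : IsOpen B) (hf : ContDiffOn ℝ ∞ f B) (hu : u ∈ B) (k i j : Fin 2) :
    christoffel f k i j u
      = ∑ l, (metric f u)⁻¹ k l * inner ℝ (partialD i (partialD j f) u) (partialD l f u) := by
  rw [christoffel, Finset.mul_sum]
  refine Finset.sum_congr rfl fun l _ => ?_
  rw [partialD_metric hB hf hu, partialD_metric hB hf hu, partialD_metric hB hf hu,
    partialD_comm hB hf hu j i, partialD_comm hB hf hu l i, partialD_comm hB hf hu l j,
    real_inner_comm (partialD i (partialD l f) u) (partialD j f u),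
    real_inner_comm (partialD j (partialD l f) u) (partialD i f u)]
  ring

theorem contDiffOn_christoffel (hB : IsOpen B) (hf : ContDiffOn ℝ ∞ f B)
    (hi : ∀ v ∈ B, Function.Injective (fderiv ℝ f v)) (k i j : Fin 2) :
    ContDiffOn ℝ ∞ (christoffel f k i j) B := by
  refine ContDiffOn.congr (f := fun u => ∑ l, (metric f u)⁻¹ k l
    * inner ℝ (partialD i (partialD j f) u) (partialD l f u)) ?_
    fun u hu => christoffel_eq hB hf hu k i j
  exact ContDiffOn.sum fun l _ => (contDiffOn_inv_metric hB hf hi k l).mul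
    ((contDiffOn_partialD hB (contDiffOn_partialD hB hf j) i).inner ℝ
      (contDiffOn_partialD hB hf l))

theorem sum_christoffel_mul_metric (hB : IsOpen B) (hf : ContDiffOn ℝ ∞ f B)
    (hi : Function.Injective (fderiv ℝ f u)) (hu : u ∈ B) (i j l : Fin 2) :
    ∑ m, christoffel f m i j u * metric f u m l
      = inner ℝ (partialD i (partialD j f) u) (partialD l f u) := by
  have hinv := Matrix.mul_nonsing_inv (metric f u) (isUnit_det_metric hi)
  have hsym : ∀ a b, metric f u a b = metric f u b a := fun a b => real_inner_comm _ _
  have hent : ∀ n, ∑ m, metric f u l m * (metric f u)⁻¹ m n = if l = n then 1 else 0 := fun n => by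
    rw [← Matrix.mul_apply, hinv, Matrix.one_apply]
  simp only [christoffel_eq hB hf hu, Finset.sum_mul]
  rw [Finset.sum_comm]
  calc _ = ∑ n, (∑ m, metric f u l m * (metric f u)⁻¹ m n)
        * inner ℝ (partialD i (partialD j f) u) (partialD n f u) := by
        refine Finset.sum_congr rfl fun n _ => ?_
        rw [Finset.sum_mul]
        refine Finset.sum_congr rfl fun m _ => ?_
        rw [hsym m l]
        ring
    _ = _ := by simp [hent]

/-- The Gauss equation of a flat submanifold: the difference `∂ⱼ∂ₖf - ∑ₘ Γᵐⱼₖ ∂ₘf` is the second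
fundamental form. -/
theorem gauss_equation (hB : IsOpen B) (hf : ContDiffOn ℝ ∞ f B)
    (hi : ∀ v ∈ B, Function.Injective (fderiv ℝ f v)) (hu : u ∈ B)
    (hR : ∀ l k i j : Fin 2, riemann f l k i j u = 0) (i j k l : Fin 2) :
    inner ℝ (partialD j (partialD k f) u - ∑ m, christoffel f m j k u • partialD m f u)
        (partialD i (partialD l f) u)
      = (inner ℝ (partialD i (partialD k f) u - ∑ m, christoffel f m i k u • partialD m f u)
        (partialD j (partialD l f) u) : ℝ) := by
  have h1 := fun i => contDiffOn_partialD hB hf i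
  have h2 := fun i j => contDiffOn_partialD hB (h1 j) i
  have d1 := fun i => differentiableAt_of_contDiffOn hB (h1 i) hu
  have d2 := fun i j => differentiableAt_of_contDiffOn hB (h2 i j) hu
  have dΓ := fun m i j => differentiableAt_of_contDiffOn hB
    (contDiffOn_christoffel hB hf hi m i j) hu
  have dg := fun i j => differentiableAt_of_contDiffOn hB (contDiffOn_metric hB hf i j) hu
  have hS := fun i j l => sum_christoffel_mul_metric hB hf (hi u hu) hu i j l
  -- Obtained by differentiating ∑ₘ Γᵐⱼₖ gₘₗ = ⟪∂ⱼ∂ₖf, ∂ₗf⟫. The third derivative is symmetric in i,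
  -- j, so subtracting the two orders leaves the curvature against the Gauss terms.
  have key : ∀ i j k : Fin 2,
      inner ℝ (partialD i (partialD j (partialD k f)) u) (partialD l f u)
        = -inner ℝ (partialD j (partialD k f) u - ∑ m, christoffel f m j k u • partialD m f u)
          (partialD i (partialD l f) u)
        + ∑ m, (partialD i (christoffel f m j k) u
          + ∑ n, christoffel f m i n u * christoffel f n j k u) * metric f u m l := by
    intro i j k
    have h := partialD_congr
      (f := fun v => ∑ m, christoffel f m j k v * metric f v m l)
      (g := fun v => (inner ℝ (partialD j (partialD k f) v) (partialD l f v) : ℝ)) hB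
      (fun v hv => sum_christoffel_mul_metric hB hf (hi v hv) hv j k l) hu i
    rw [partialD_inner (d2 j k) (d1 l),
      partialD_sum Finset.univ (fun m _ => (dΓ m j k).fun_mul (dg m l))] at h
    simp only [fun m => partialD_mul (dΓ m j k) (dg m l) i, partialD_metric hB hf hu, ← hS] at h
    rw [inner_sub_left, sum_inner]
    simp only [real_inner_smul_left, Fin.sum_univ_two] at h ⊢
    linear_combination -h
  have e1 := key i j k
  have e2 := key j i k
  rw [partialD_comm hB (h1 k) hu j i] at e2
  have hR' : ∑ m, (partialD i (christoffel f m j k) u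
      + ∑ n, christoffel f m i n u * christoffel f n j k u) * metric f u m l
    = ∑ m, (partialD j (christoffel f m i k) u
      + ∑ n, christoffel f m j n u * christoffel f n i k u) * metric f u m l := by
    refine Finset.sum_congr rfl fun m _ => ?_
    congr 1
    have := hR m k i j
    rw [riemann, Finset.sum_sub_distrib] at this
    linarith
  rw [hR'] at e1
  linarith

end GaussEquation

/-! ### Parallel tangent frames and flat coordinates -/

/-- A flat Lagrangian self-shrinker in a local parametrization. -/
structure IsFlatLagrangianChart (f : RSpace 2 → C2) (B : Set (RSpace 2)) : Prop where
  contDiffOn : ContDiffOn ℝ ∞ f B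
  injective : ∀ u ∈ B, Function.Injective (fderiv ℝ f u)
  lagrangian : ∀ u ∈ B, ∀ j k, inner ℝ (Complex.I • partialD j f u) (partialD k f u) = (0 : ℝ)
  shrinker : ∀ u ∈ B, meanCurvature f u = -normalPart f u (f u)
  flat : ∀ u ∈ B, ∀ l k i j, riemann f l k i j u = 0

/-- A smooth orthonormal frame of the tangent planes; for a Lagrangian surface it is unitary. -/
structure IsTangentFrame (f : RSpace 2 → C2) (B : Set (RSpace 2)) (e : Fin 2 → RSpace 2 → C2) :
    Prop where
  contDiffOn : ∀ k, ContDiffOn ℝ ∞ (e k) B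
  orthonormal : ∀ u ∈ B, Orthonormal ℂ fun k => e k u
  tangent : ∃ P : Fin 2 → Fin 2 → RSpace 2 → ℝ, (∀ k j, ContDiffOn ℝ ∞ (P k j) B) ∧
    ∀ u ∈ B, ∀ k, e k u = ∑ j, P k j u • partialD j f u

variable {f : RSpace 2 → C2} {B : Set (RSpace 2)} {u : RSpace 2} {e : Fin 2 → RSpace 2 → C2}

theorem IsFlatLagrangianChart.exists_isTangentFrame (hf : IsFlatLagrangianChart f B)
    (hB : IsOpen B) : ∃ e, IsTangentFrame f B e := by
  have h1 := fun i => contDiffOn_partialD hB hf.1 i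
  have hli := fun u hu => linearIndependent_partialD (hf.injective u hu)
  have hn0 : ∀ u ∈ B, partialD 0 f u ≠ 0 := fun u hu => (hli u hu).ne_zero 0
  set p : RSpace 2 → ℝ := fun u => ‖partialD 0 f u‖⁻¹ with hp
  have hps : ContDiffOn ℝ ∞ p B :=
    ((h1 0).norm ℝ hn0).inv fun u hu => norm_ne_zero_iff.mpr (hn0 u hu)
  -- Gram–Schmidt: `t` is the coefficient that makes t ∂₀f + ∂₁f orthogonal to ∂₀f.
  set t : RSpace 2 → ℝ := fun u => -(inner ℝ (partialD 0 f u) (partialD 1 f u) * (p u * p u))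
  have hts : ContDiffOn ℝ ∞ t B := (((h1 0).inner ℝ (h1 1)).mul (hps.mul hps)).neg
  set w : RSpace 2 → C2 := fun u => t u • partialD 0 f u + partialD 1 f u with hw
  have hws : ContDiffOn ℝ ∞ w B := (hts.smul (h1 0)).add (h1 1)
  have hw0 : ∀ u ∈ B, w u ≠ 0 := fun u hu h => by
    have := Fintype.linearIndependent_iff.mp (hli u hu) ![t u, 1]
      (by simpa [Fin.sum_univ_two] using h) 1
    simp at this
  set q : RSpace 2 → ℝ := fun u => ‖w u‖⁻¹ with hq
  have hqs : ContDiffOn ℝ ∞ q B :=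
    (hws.norm ℝ hw0).inv fun u hu => norm_ne_zero_iff.mpr (hw0 u hu)
  refine ⟨![fun u => p u • partialD 0 f u, fun u => q u • w u], ?_, ?_,
    ![![p, fun _ => 0], ![fun u => q u * t u, q]], ?_, ?_⟩
  · intro k
    fin_cases k
    · exact hps.smul (h1 0)
    · exact hqs.smul hws
  · intro u hu
    have hn := norm_ne_zero_iff.mpr (hn0 u hu)
    have hnw := norm_ne_zero_iff.mpr (hw0 u hu)
    have hx : inner ℝ (partialD 0 f u) (w u) = (0 : ℝ) := by
      simp only [hw, t, hp, inner_add_right, real_inner_smul_right, real_inner_self_eq_norm_sq]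
      field_simp
      ring
    have hL := hf.lagrangian u hu
    rw [orthonormal_complex_iff]
    constructor
    · intro j k
      fin_cases j <;> fin_cases k
      · change inner ℝ (‖partialD 0 f u‖⁻¹ • partialD 0 f u) (‖partialD 0 f u‖⁻¹ • partialD 0 f u)
          = (1 : ℝ)
        rw [real_inner_smul_left, real_inner_smul_right, real_inner_self_eq_norm_sq]
        field_simp
      · simp [real_inner_smul_left, real_inner_smul_right, hx]
      · simp [real_inner_smul_left, real_inner_smul_right, real_inner_comm, hx]
      · change inner ℝ (‖w u‖⁻¹ • w u) (‖w u‖⁻¹ • w u) = (1 : ℝ)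
        rw [real_inner_smul_left, real_inner_smul_right, real_inner_self_eq_norm_sq]
        field_simp
    · intro j k
      fin_cases j <;> fin_cases k <;>
        simp [hw, smul_comm Complex.I (_ : ℝ), inner_add_left, inner_add_right,
          real_inner_smul_left, real_inner_smul_right, hL]
  · intro k j
    fin_cases k <;> fin_cases j
    · exact hps
    · exact contDiffOn_const
    · exact hqs.mul hts
    · exact hqs
  · intro u hu k
    fin_cases k
    · simp
    · simp [hw, smul_smul]

namespace IsTangentFrame

theorem inner_I_smul_eq_zero (he : IsTangentFrame f B e) (hf : IsFlatLagrangianChart f B)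
    (hu : u ∈ B) (k j : Fin 2) : inner ℝ (Complex.I • e k u) (partialD j f u) = (0 : ℝ) := by
  obtain ⟨P, -, hP⟩ := he.tangent
  rw [hP u hu k, Finset.smul_sum, sum_inner]
  exact Finset.sum_eq_zero fun l _ => by
    rw [smul_comm, real_inner_smul_left, hf.lagrangian u hu, mul_zero]

theorem partialD_eq_sum (he : IsTangentFrame f B e) (hf : IsFlatLagrangianChart f B)
    (hu : u ∈ B) (j : Fin 2) :
    partialD j f u = ∑ k, (inner ℝ (e k u) (partialD j f u) : ℝ) • e k u := by
  conv_lhs => rw [Orthonormal.eq_sum_frame (he.orthonormal u hu) (partialD j f u)]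
  simp [he.inner_I_smul_eq_zero hf hu]

theorem inner_partialD_self (he : IsTangentFrame f B e) (hB : IsOpen B) (hu : u ∈ B)
    (i k l : Fin 2) : inner ℝ (e k u) (partialD i (e l) u)
      = -(inner ℝ (e l u) (partialD i (e k) u) : ℝ) := by
  have d := fun k => differentiableAt_of_contDiffOn hB (he.contDiffOn k) hu
  have h := partialD_congr (f := fun v => inner ℝ (e k v) (e l v))
    (g := fun _ => if k = l then (1 : ℝ) else 0) hB
    (fun v hv => (orthonormal_complex_iff.mp (he.orthonormal v hv)).1 k l) hu i
  rw [partialD_const, partialD_inner (d k) (d l), real_inner_comm (e l u)] at h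
  linarith

/-- Derivatives of the coefficients `P` contribute only tangent vectors, which i eₖ annihilates. -/
theorem inner_I_smul_partialD (he : IsTangentFrame f B e) (hf : IsFlatLagrangianChart f B)
    (hB : IsOpen B) (hu : u ∈ B) {P : Fin 2 → Fin 2 → RSpace 2 → ℝ}
    (hPs : ∀ k j, ContDiffOn ℝ ∞ (P k j) B)
    (hP : ∀ u ∈ B, ∀ k, e k u = ∑ j, P k j u • partialD j f u) (i j k : Fin 2) :
    inner ℝ (Complex.I • e k u) (partialD i (e j) u)
      = ∑ l, P j l u * inner ℝ (Complex.I • e k u) (partialD i (partialD l f) u) := by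
  have dP := fun l => differentiableAt_of_contDiffOn hB (hPs j l) hu
  have d1 := fun l => differentiableAt_of_contDiffOn hB (contDiffOn_partialD hB hf.1 l) hu
  rw [partialD_congr hB (fun v hv => hP v hv j) hu,
    partialD_sum Finset.univ (fun l _ => (dP l).fun_smul (d1 l)), inner_sum]
  refine Finset.sum_congr rfl fun l _ => ?_
  rw [partialD_smul (dP l) (d1 l), inner_add_right, real_inner_smul_right, real_inner_smul_right,
    he.inner_I_smul_eq_zero hf hu, mul_zero, add_zero]

/-- The Gauss equation in terms of a unitary tangent frame. -/
theorem gauss_frame (he : IsTangentFrame f B e) (hf : IsFlatLagrangianChart f B)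
    (hB : IsOpen B) (hu : u ∈ B) :
    ∑ k, (inner ℝ (Complex.I • e k u) (partialD 1 (partialD 1 f) u) : ℝ)
        * inner ℝ (Complex.I • e k u) (partialD 0 (partialD 0 f) u)
      = ∑ k, (inner ℝ (Complex.I • e k u) (partialD 0 (partialD 1 f) u) : ℝ)
        * inner ℝ (Complex.I • e k u) (partialD 0 (partialD 1 f) u) := by
  -- The Christoffel-corrected second derivative is normal, so its pairing with any v involves only
  -- the i eₖ components.
  have key : ∀ i j : Fin 2, ∀ v : C2,
      inner ℝ (partialD i (partialD j f) u - ∑ m, christoffel f m i j u • partialD m f u) v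
      = ∑ k, (inner ℝ (Complex.I • e k u) (partialD i (partialD j f) u) : ℝ)
        * inner ℝ (Complex.I • e k u) v := by
    intro i j v
    obtain ⟨P, -, hP⟩ := he.tangent
    have h0 : ∀ l, inner ℝ (partialD l f u)
        (partialD i (partialD j f) u - ∑ m, christoffel f m i j u • partialD m f u) = (0 : ℝ) := by
      intro l
      rw [inner_sub_right, inner_sum, ← real_inner_comm,
        ← sum_christoffel_mul_metric hB hf.1 (hf.injective u hu) hu, sub_eq_zero]
      refine Finset.sum_congr rfl fun m _ => ?_
      rw [real_inner_smul_right, real_inner_comm]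
      rfl
    rw [Orthonormal.inner_eq_sum_frame (he.orthonormal u hu)]
    refine Finset.sum_congr rfl fun k _ => ?_
    have h1 : inner ℝ (e k u)
        (partialD i (partialD j f) u - ∑ m, christoffel f m i j u • partialD m f u) = (0 : ℝ) := by
      rw [hP u hu k, sum_inner]
      exact Finset.sum_eq_zero fun l _ => by rw [real_inner_smul_left, h0, mul_zero]
    have h2 : inner ℝ (Complex.I • e k u)
        (partialD i (partialD j f) u - ∑ m, christoffel f m i j u • partialD m f u)
        = (inner ℝ (Complex.I • e k u) (partialD i (partialD j f) u) : ℝ) := by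
      rw [inner_sub_right, inner_sum, sub_eq_self]
      exact Finset.sum_eq_zero fun l _ => by
        rw [real_inner_smul_right, he.inner_I_smul_eq_zero hf hu, mul_zero]
    rw [h1, h2, zero_mul, zero_add]
  have := gauss_equation hB hf.1 hf.injective hu (hf.flat u hu) 0 1 1 0
  rwa [key, key, partialD_comm hB hf.1 hu 1 0] at this

/-- The connection form of a tangent frame of a flat surface is closed. -/
theorem connection_closed (he : IsTangentFrame f B e) (hf : IsFlatLagrangianChart f B)
    (hB : IsOpen B) (hu : u ∈ B) :
    partialD 0 (fun v => (inner ℝ (partialD 1 (e 0) v) (e 1 v) : ℝ)) u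
      = partialD 1 (fun v => (inner ℝ (partialD 0 (e 0) v) (e 1 v) : ℝ)) u := by
  obtain ⟨P, hPs, hP⟩ := he.tangent
  have d := fun k => differentiableAt_of_contDiffOn hB (he.contDiffOn k) hu
  have d1 := fun i k =>
    differentiableAt_of_contDiffOn hB (contDiffOn_partialD hB (he.contDiffOn k) i) hu
  rw [partialD_inner (d1 1 0) (d 1), partialD_inner (d1 0 0) (d 1),
    partialD_comm hB (he.contDiffOn 0) hu 1 0, add_left_inj,
    Orthonormal.inner_eq_sum_frame (he.orthonormal u hu),
    Orthonormal.inner_eq_sum_frame (he.orthonormal u hu)]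
  -- What remains to compare is ⟪∂₁e₀, ∂₀e₁⟫ with ⟪∂₀e₀, ∂₁e₁⟫. In a two-dimensional unit frame ∂ᵢe₀
  -- has tangential part along e₁ only and ∂ⱼe₁ along e₀ only, so only normal components contribute.
  have z : ∀ i k, inner ℝ (e k u) (partialD i (e k) u) = (0 : ℝ) := fun i k => by
    have := he.inner_partialD_self hB hu i k k
    linarith
  have hg := he.gauss_frame hf hB hu
  simp only [he.inner_I_smul_partialD hf hB hu hPs hP, Fin.sum_univ_two, z, zero_mul, mul_zero,
    zero_add, partialD_comm hB hf.1 hu 1 0] at hg ⊢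
  -- The difference of the normal contributions is, up to sign, det P times the Gauss equation.
  linear_combination (P 0 1 u * P 1 0 u - P 0 0 u * P 1 1 u) * hg

end IsTangentFrame

/-- A flat Lagrangian surface has a parallel tangent frame on convex sets. -/
theorem IsFlatLagrangianChart.exists_parallel_frame (hf : IsFlatLagrangianChart f B)
    (hB : IsOpen B) (hc : Convex ℝ B) : ∃ e, IsTangentFrame f B e ∧
      ∀ u ∈ B, ∀ i k l, inner ℝ (e k u) (partialD i (e l) u) = (0 : ℝ) := by
  obtain ⟨e, he⟩ := hf.exists_isTangentFrame hB
  -- θ is a primitive of the connection form; turning the frame through θ cancels its tangential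
  -- derivatives.
  obtain ⟨θ, hθs, hθ⟩ := exists_partialD_eq hB hc
    (a := fun j v => (inner ℝ (partialD j (e 0) v) (e 1 v) : ℝ))
    (fun j => (contDiffOn_partialD hB (he.contDiffOn 0) j).inner ℝ (he.contDiffOn 1))
    (fun v hv i j => by
      fin_cases i <;> fin_cases j
      · rfl
      · exact he.connection_closed hf hB hv
      · exact (he.connection_closed hf hB hv).symm
      · rfl)
  set C : RSpace 2 → ℝ := fun v => Real.cos (θ v) with hC
  set S : RSpace 2 → ℝ := fun v => Real.sin (θ v) with hS
  have hCs : ContDiffOn ℝ ∞ C B := hθs.cos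
  have hSs : ContDiffOn ℝ ∞ S B := hθs.sin
  have hCS : ∀ v, C v ^ 2 + S v ^ 2 = 1 := fun v => Real.cos_sq_add_sin_sq _
  have hdC : ∀ u ∈ B, ∀ i, partialD i C u = -S u * partialD i θ u := fun u hu i => by
    have := (differentiableAt_of_contDiffOn hB hθs hu).hasFDerivAt.cos.fderiv
    simp [partialD, hC, hS, this]
  have hdS : ∀ u ∈ B, ∀ i, partialD i S u = C u * partialD i θ u := fun u hu i => by
    have := (differentiableAt_of_contDiffOn hB hθs hu).hasFDerivAt.sin.fderiv
    simp [partialD, hC, hS, this]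
  set e' : Fin 2 → RSpace 2 → C2 :=
    ![fun v => C v • e 0 v - S v • e 1 v, fun v => S v • e 0 v + C v • e 1 v] with he'
  have hframe : IsTangentFrame f B e' := by
    refine ⟨?_, ?_, ?_⟩
    · intro k
      fin_cases k
      · exact (hCs.smul (he.contDiffOn 0)).sub (hSs.smul (he.contDiffOn 1))
      · exact (hSs.smul (he.contDiffOn 0)).add (hCs.smul (he.contDiffOn 1))
    · intro u hu
      obtain ⟨h1, h2⟩ := orthonormal_complex_iff.mp (he.orthonormal u hu)
      have h := hCS u
      rw [orthonormal_complex_iff]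
      constructor <;> intro j k <;> fin_cases j <;> fin_cases k <;>
        simp only [he', Fin.zero_eta, Fin.mk_one, Matrix.cons_val_zero, Matrix.cons_val_one,
          smul_add, smul_sub, smul_comm Complex.I (_ : ℝ), inner_sub_left, inner_sub_right,
          inner_add_left, inner_add_right, real_inner_smul_left, real_inner_smul_right, h1, h2] <;>
        simp <;> first | linear_combination h | ring
    · obtain ⟨P, hPs, hP⟩ := he.tangent
      refine ⟨![fun j v => C v * P 0 j v - S v * P 1 j v, fun j v => S v * P 0 j v + C v * P 1 j v],
        ?_, ?_⟩
      · intro k j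
        fin_cases k
        · exact (hCs.mul (hPs 0 j)).sub (hSs.mul (hPs 1 j))
        · exact (hSs.mul (hPs 0 j)).add (hCs.mul (hPs 1 j))
      · intro u hu k
        fin_cases k
        · change C u • e 0 u - S u • e 1 u
            = ∑ j, (C u * P 0 j u - S u * P 1 j u) • partialD j f u
          simp only [hP u hu, Fin.sum_univ_two]
          module
        · change S u • e 0 u + C u • e 1 u
            = ∑ j, (S u * P 0 j u + C u * P 1 j u) • partialD j f u
          simp only [hP u hu, Fin.sum_univ_two]
          module
  refine ⟨e', hframe, fun u hu i => ?_⟩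
  have hself := fun k => hframe.inner_partialD_self hB hu i k k
  have h01 : inner ℝ (e' 1 u) (partialD i (e' 0) u) = (0 : ℝ) := by
    have d := fun k => differentiableAt_of_contDiffOn hB (he.contDiffOn k) hu
    have dC := differentiableAt_of_contDiffOn hB hCs hu
    have dS := differentiableAt_of_contDiffOn hB hSs hu
    have h1 := (orthonormal_complex_iff.mp (he.orthonormal u hu)).1
    have hs := he.inner_partialD_self hB hu i
    have z : ∀ k, inner ℝ (e k u) (partialD i (e k) u) = (0 : ℝ) := fun k => by
      have := hs k k
      linarith
    change inner ℝ (S u • e 0 u + C u • e 1 u)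
      (partialD i (fun v => C v • e 0 v - S v • e 1 v) u) = (0 : ℝ)
    rw [partialD_sub (dC.fun_smul (d 0)) (dS.fun_smul (d 1)), partialD_smul dC (d 0),
      partialD_smul dS (d 1), hdC u hu, hdS u hu, hθ u hu,
      real_inner_comm (e 1 u)]
    simp only [inner_sub_right, inner_add_left, inner_add_right, real_inner_smul_left,
      real_inner_smul_right, h1, hs 0 1, z]
    simp
    ring
  have h10 := hframe.inner_partialD_self hB hu i 0 1
  intro k l
  fin_cases k <;> fin_cases l
  · have := hself 0
    change inner ℝ (e' 0 u) (partialD i (e' 0) u) = (0 : ℝ)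
    linarith
  · change inner ℝ (e' 0 u) (partialD i (e' 1) u) = (0 : ℝ)
    linarith
  · exact h01
  · have := hself 1
    change inner ℝ (e' 1 u) (partialD i (e' 1) u) = (0 : ℝ)
    linarith

variable {f : RSpace 2 → C2} {B : Set (RSpace 2)} {u : RSpace 2} {e : Fin 2 → RSpace 2 → C2}

/-- If `v` is the coordinate vector of a tangent vector `w`, then `v = g⁻¹ η`, where `η = ⟪w, ·⟫`. -/
theorem IsFlatLagrangianChart.sum_inv_metric_mul (hf : IsFlatLagrangianChart f B)
    (hu : u ∈ B) {w : C2} {v : RSpace 2} (hv : fderiv ℝ f u v = w) (i : Fin 2) :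
    ∑ j, (metric f u)⁻¹ i j * inner ℝ (w) (partialD j f u) = v i := by
  have h1 : ∀ j, inner ℝ (w) (partialD j f u) = ((metric f u).mulVec v) j := fun j => by
    rw [← hv, fderiv_apply_eq_sum_partialD, sum_inner, Matrix.mulVec, dotProduct]
    refine Finset.sum_congr rfl fun m _ => ?_
    rw [real_inner_smul_left, real_inner_comm, mul_comm]
    rfl
  have h2 : (metric f u)⁻¹.mulVec ((metric f u).mulVec v) = v := by
    rw [Matrix.mulVec_mulVec, Matrix.nonsing_inv_mul _ (isUnit_det_metric (hf.injective u hu)),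
      Matrix.one_mulVec]
  simp only [h1]
  exact congrFun h2 i

theorem inner_normalPart {z : C2} (hz : ∀ v, inner ℝ (fderiv ℝ f u v) z = (0 : ℝ)) (w : C2) :
    inner ℝ z (normalPart f u w) = (inner ℝ z w : ℝ) := by
  have hmem : z ∈ (tangentPlane f u)ᗮ := by
    rw [Submodule.mem_orthogonal]
    rintro x ⟨v, rfl⟩
    exact hz v
  rw [normalPart, ← Submodule.inner_starProjection_left_eq_right,
    Submodule.starProjection_eq_self_iff.mpr hmem]

namespace IsTangentFrame

theorem inner_I_smul_fderiv (he : IsTangentFrame f B e) (hf : IsFlatLagrangianChart f B)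
    (hu : u ∈ B) (k : Fin 2) (v : RSpace 2) :
    inner ℝ (fderiv ℝ f u v) (Complex.I • e k u) = (0 : ℝ) := by
  rw [real_inner_comm, fderiv_apply_eq_sum_partialD, inner_sum]
  exact Finset.sum_eq_zero fun j _ => by
    rw [real_inner_smul_right, he.inner_I_smul_eq_zero hf hu, mul_zero]

theorem fderiv_eq_sum (he : IsTangentFrame f B e) (hf : IsFlatLagrangianChart f B)
    (hu : u ∈ B) (v : RSpace 2) :
    fderiv ℝ f u v = ∑ k, (inner ℝ (e k u) (fderiv ℝ f u v) : ℝ) • e k u := by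
  conv_lhs => rw [Orthonormal.eq_sum_frame (he.orthonormal u hu) (fderiv ℝ f u v)]
  simp [fun k => (real_inner_comm _ _).trans (he.inner_I_smul_fderiv hf hu k v)]

/-- The self-shrinker equation paired with the normal vector `i eₗ`. -/
theorem shrinker_frame (he : IsTangentFrame f B e) (hf : IsFlatLagrangianChart f B)
    (hu : u ∈ B) (l : Fin 2) :
    ∑ i, ∑ j, (metric f u)⁻¹ i j
        * inner ℝ (Complex.I • e l u) (partialD i (partialD j f) u)
      = -(inner ℝ (Complex.I • e l u) (f u) : ℝ) := by
  have hz := he.inner_I_smul_fderiv hf hu l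
  have h := congrArg (fun w => (inner ℝ (Complex.I • e l u) w : ℝ)) (hf.shrinker u hu)
  simp only [meanCurvature, secondFF, inner_sum, real_inner_smul_right, inner_neg_right,
    inner_normalPart hz] at h
  exact h

/-- Differentiate ∂ⱼf = ∑ ⟪eₖ, ∂ⱼf⟫ eₖ; derivatives of the coefficients give tangent terms,
orthogonal to i eₗ. -/
theorem inner_second_eq (he : IsTangentFrame f B e) (hf : IsFlatLagrangianChart f B)
    (hB : IsOpen B) (hu : u ∈ B) (l i j : Fin 2) :
    inner ℝ (Complex.I • e l u) (partialD i (partialD j f) u)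
      = ∑ k, inner ℝ (e k u) (partialD j f u)
        * (inner ℝ (Complex.I • e l u) (partialD i (e k) u) : ℝ) := by
  have h1 := contDiffOn_partialD hB hf.1 j
  have de := fun k => differentiableAt_of_contDiffOn hB (he.contDiffOn k) hu
  have dη := fun k => differentiableAt_of_contDiffOn hB ((he.contDiffOn k).inner ℝ h1) hu
  rw [partialD_congr hB (fun v hv => he.partialD_eq_sum hf hv j) hu,
    partialD_sum Finset.univ (fun k _ => (dη k).fun_smul (de k)), inner_sum]
  refine Finset.sum_congr rfl fun k _ => ?_
  rw [partialD_smul (dη k) (de k), inner_add_right, real_inner_smul_right, real_inner_smul_right,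
    (orthonormal_complex_iff.mp (he.orthonormal u hu)).2, mul_zero, add_zero]

end IsTangentFrame

/-- A flat Lagrangian self-shrinker admits flat coordinates near every point. -/
theorem IsFlatLagrangianChart.exists_flat_coordinates (hf : IsFlatLagrangianChart f B)
    (hB : IsOpen B) (hc : Convex ℝ B) {p : RSpace 2} (hp : p ∈ B) :
    ∃ Φ : OpenPartialHomeomorph (RSpace 2) (RSpace 2), p ∈ Φ.source ∧ Φ.source ⊆ B ∧
      ContDiffOn ℝ ∞ Φ Φ.source ∧ ContDiffOn ℝ ∞ Φ.symm Φ.target ∧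
      IsFlatLagrangianShrinker (fun y => f (Φ.symm y)) Φ.target := by
  obtain ⟨e, he, hpar⟩ := hf.exists_parallel_frame hB hc
  have h1 := fun j => contDiffOn_partialD hB hf.1 j
  -- The dual coframe ⟪eₖ, df⟫ is closed: its exterior derivative contains only ⟪∂ᵢeₖ, ∂ⱼf⟫, zero
  -- for a parallel frame, and commuting second derivatives. Its primitives are the flat
  -- coordinates.
  have hprim : ∀ k, ∃ φ : RSpace 2 → ℝ, ContDiffOn ℝ ∞ φ B ∧
      ∀ v ∈ B, ∀ j, partialD j φ v = inner ℝ (e k v) (partialD j f v) := by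
    intro k
    refine exists_partialD_eq hB hc (a := fun j v => (inner ℝ (e k v) (partialD j f v) : ℝ))
      (fun j => (he.contDiffOn k).inner ℝ (h1 j)) fun v hv i j => ?_
    have de := differentiableAt_of_contDiffOn hB (he.contDiffOn k) hv
    have d1 := fun j => differentiableAt_of_contDiffOn hB (h1 j) hv
    have z : ∀ i j, inner ℝ (partialD i (e k) v) (partialD j f v) = (0 : ℝ) := fun i j => by
      rw [he.partialD_eq_sum hf hv j, inner_sum]
      exact Finset.sum_eq_zero fun l _ => by
        rw [real_inner_smul_right, real_inner_comm (e l v), hpar v hv, mul_zero]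
    rw [partialD_inner de (d1 j), partialD_inner de (d1 i), z, z, partialD_comm hB hf.1 hv]
  choose φ hφs hφ using hprim
  set φ' : RSpace 2 → RSpace 2 := fun v => WithLp.toLp 2 fun k => φ k v with hφ'
  have hφ's : ContDiffOn ℝ ∞ φ' B := contDiffOn_euclidean.mpr fun k => hφs k
  have hfd : ∀ v ∈ B, ∀ w k, fderiv ℝ φ' v w k = inner ℝ (e k v) (fderiv ℝ f v w) := by
    intro v hv w k
    have e1 : fderiv ℝ φ' v w k = fderiv ℝ (φ k) v w := by
      have := ((EuclideanSpace.proj k : RSpace 2 →L[ℝ] ℝ).hasFDerivAt.comp v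
        (differentiableAt_of_contDiffOn hB hφ's hv).hasFDerivAt).fderiv
      change fderiv ℝ (φ k) v = _ at this
      rw [this]
      rfl
    rw [e1, fderiv_apply_eq_sum_partialD, fderiv_apply_eq_sum_partialD, inner_sum]
    exact Finset.sum_congr rfl fun j _ => by rw [hφ k v hv, real_inner_smul_right, smul_eq_mul]
  have hinj : ∀ v ∈ B, Function.Injective (fderiv ℝ φ' v) := by
    intro v hv
    rw [injective_iff_map_eq_zero]
    intro w hw
    refine (injective_iff_map_eq_zero _).mp (hf.injective v hv) w ?_
    rw [he.fderiv_eq_sum hf hv w]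
    refine Finset.sum_eq_zero fun k _ => ?_
    rw [← hfd v hv w k, hw]
    simp
  have hequiv : ∀ v ∈ B, ∃ A : RSpace 2 ≃L[ℝ] RSpace 2,
      (A : RSpace 2 →L[ℝ] RSpace 2) = fderiv ℝ φ' v := fun v hv =>
    ⟨(LinearEquiv.ofInjectiveEndo (fderiv ℝ φ' v : RSpace 2 →ₗ[ℝ] RSpace 2)
      (hinj v hv)).toContinuousLinearEquiv, by ext1 w; rfl⟩
  choose! A hA using hequiv
  have hder : ∀ v ∈ B, HasFDerivAt φ' (A v : RSpace 2 →L[ℝ] RSpace 2) v := fun v hv => by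
    rw [hA v hv]
    exact (differentiableAt_of_contDiffOn hB hφ's hv).hasFDerivAt
  set Φ := (((hφ's.contDiffAt (hB.mem_nhds hp)).toOpenPartialHomeomorph φ' (hder p hp)
    (by simp)).restrOpen B hB) with hΦ
  have hΦB : Φ.source ⊆ B := by
    rw [hΦ, OpenPartialHomeomorph.restrOpen_source]
    exact Set.inter_subset_right
  have hsymm : ∀ y ∈ Φ.target, Φ.symm y ∈ B := fun y hy => hΦB (Φ.map_target hy)
  have hsd : ∀ y ∈ Φ.target, HasFDerivAt Φ.symm
      ((A (Φ.symm y)).symm : RSpace 2 →L[ℝ] RSpace 2) y := fun y hy =>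
    Φ.hasFDerivAt_symm hy (hder _ (hsymm y hy))
  have hsc : ContDiffOn ℝ ∞ Φ.symm Φ.target := fun y hy =>
    (Φ.contDiffAt_symm hy (hder _ (hsymm y hy))
      (hφ's.contDiffAt (hB.mem_nhds (hsymm y hy)))).contDiffWithinAt
  set F : RSpace 2 → C2 := fun y => f (Φ.symm y) with hF
  -- The differential of the coordinates gives the components of df in the frame, so its inverse
  -- sends the k-th basis vector to the coordinate vector of eₖ.
  have hcol : ∀ v ∈ B, ∀ k, fderiv ℝ f v ((A v).symm (EuclideanSpace.single k 1)) = e k v := by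
    intro v hv k
    rw [he.fderiv_eq_sum hf hv]
    have : ∀ l, inner ℝ (e l v) (fderiv ℝ f v ((A v).symm (EuclideanSpace.single k 1)))
        = if l = k then (1 : ℝ) else 0 := fun l => by
      rw [← hfd v hv, ← hA v hv, ContinuousLinearEquiv.coe_coe,
        ContinuousLinearEquiv.apply_symm_apply]
      simp
    simp [this]
  have hFk : ∀ y ∈ Φ.target, ∀ k, partialD k F y = e k (Φ.symm y) := by
    intro y hy k
    have := ((differentiableAt_of_contDiffOn hB hf.1 (hsymm y hy)).hasFDerivAt.comp y
      (hsd y hy)).fderiv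
    change fderiv ℝ (f ∘ Φ.symm) y _ = _
    rw [this]
    exact hcol _ (hsymm y hy) k
  have hFkk : ∀ y ∈ Φ.target, ∀ k, partialD k (partialD k F) y
      = ∑ i, ((A (Φ.symm y)).symm (EuclideanSpace.single k 1)) i
        • partialD i (e k) (Φ.symm y) := by
    intro y hy k
    rw [partialD_congr Φ.open_target (fun z hz => hFk z hz k) hy]
    have := ((differentiableAt_of_contDiffOn hB (he.contDiffOn k) (hsymm y hy)).hasFDerivAt.comp y
      (hsd y hy)).fderiv
    change fderiv ℝ (e k ∘ Φ.symm) y _ = _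
    rw [this]
    exact fderiv_apply_eq_sum_partialD _ _ _
  refine ⟨Φ, ?_, hΦB, hφ's.mono hΦB, hsc, ?_, fun y hy => ?_, fun y hy => ?_⟩
  · rw [hΦ, OpenPartialHomeomorph.restrOpen_source]
    exact ⟨ContDiffAt.mem_toOpenPartialHomeomorph_source _ _ _, hp⟩
  · exact hf.1.comp hsc hsymm
  · change Orthonormal ℂ fun j => partialD j F y
    simp only [hFk y hy]
    exact he.orthonormal _ (hsymm y hy)
  · have hu := hsymm y hy
    obtain ⟨o1, o2⟩ := orthonormal_complex_iff.mp (he.orthonormal _ hu)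
    change partialD 0 (partialD 0 F) y + partialD 1 (partialD 1 F) y
      = -(F y - ∑ k, (inner ℝ (F y) (partialD k F y) : ℝ) • partialD k F y)
    simp only [hFkk y hy, hFk y hy]
    rw [← Fin.sum_univ_two fun k => ∑ i, ((A (Φ.symm y)).symm (EuclideanSpace.single k 1)) i
        • partialD i (e k) (Φ.symm y)]
    rw [Orthonormal.eq_sum_frame (he.orthonormal _ hu) (∑ k, ∑ i, _),
      Orthonormal.eq_sum_frame (he.orthonormal _ hu) (-_)]
    refine Finset.sum_congr rfl fun l _ => ?_
    congr 2
    -- Tangential components: the left side vanishes because the frame is parallel, the right side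
    -- because the tangential part of F has been subtracted.
    · simp only [inner_sum, real_inner_smul_right, hpar _ hu, inner_neg_right, inner_sub_right, o1]
      simp [real_inner_comm]
    · simp only [inner_sum, real_inner_smul_right, inner_neg_right, inner_sub_right, o2, mul_zero,
        Finset.sum_const_zero, sub_zero]
      -- Normal components: the mean curvature equation in the original chart, with the inverse
      -- metric traded for the coordinate vectors of the eₖ by `sum_inv_metric_mul`.
      rw [← he.shrinker_frame hf hu l]
      simp only [he.inner_second_eq hf hB hu,
        ← fun k => hf.sum_inv_metric_mul hu (hcol _ hu k)]
      simp only [Fin.sum_univ_two]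
      ring

/-- A flat Lagrangian self-shrinker is locally a product of two Abresch–Langer curves. -/
theorem IsFlatLagrangianChart.exists_product (hf : IsFlatLagrangianChart f B)
    (hB : IsOpen B) (hc : Convex ℝ B) {p : RSpace 2} (hp : p ∈ B) :
    ∃ γ₁ γ₂ : ℝ → ℂ, IsAbreschLangerCurve γ₁ ∧ IsAbreschLangerCurve γ₂ ∧ ∃ T : C2 ≃ₗᵢ[ℂ] C2,
    ∃ Ψ : OpenPartialHomeomorph (RSpace 2) (RSpace 2), p ∈ Ψ.source ∧ Ψ.source ⊆ B ∧
      ContDiffOn ℝ ∞ Ψ Ψ.source ∧ ContDiffOn ℝ ∞ Ψ.symm Ψ.target ∧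
      ∀ u ∈ Ψ.source, f u = T !₂[γ₁ (Ψ u 0), γ₂ (Ψ u 1)] := by
  obtain ⟨Φ, hpΦ, hΦB, hΦ, hΦ', hF⟩ := hf.exists_flat_coordinates hB hc hp
  obtain ⟨c, s, hcs, B', hB'sub, hB', hpB', hdiag⟩ :=
    hF.exists_diagonal_direction Φ.open_target (Φ.map_source hpΦ)
  obtain ⟨hG, hG01⟩ := IsFlatLagrangianShrinker.comp_rotation hcs hB' (hF.mono hB'sub)
  set R := rotation c s hcs
  set q := R.symm (Φ p) with hq
  have hRq : R q = Φ p := R.apply_symm_apply _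
  obtain ⟨r, hr, hball⟩ := Metric.isOpen_iff.mp (hB'.preimage R.continuous) q
    (by rw [Set.mem_preimage, hRq]; exact hpB')
  obtain ⟨γ₁, γ₂, h1, h2, T, hT⟩ := IsFlatLagrangianShrinker.exists_product hr (hG.mono hball)
    (fun u hu => (hG01 u (hball hu)).trans (hdiag _ (hball hu)))
  obtain ⟨N, hN, hNo, hqN⟩ := eventually_nhds_iff.mp hT
  set Ψ₀ := Φ.trans R.symm.toHomeomorph.toOpenPartialHomeomorph with hΨ₀
  have hsrc : Ψ₀.source = Φ.source := by simp [hΨ₀]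
  -- The product formula holds only on the neighbourhood N of q, so the coordinates are cut down to
  -- its preimage.
  have hopen : IsOpen (Ψ₀.source ∩ Ψ₀ ⁻¹' N) := Ψ₀.isOpen_inter_preimage hNo
  set Ψ := Ψ₀.restrOpen _ hopen with hΨ
  have hΨs : Ψ.source ⊆ Φ.source := fun v hv => by
    rw [← hsrc]
    exact hv.1
  refine ⟨γ₁, γ₂, h1, h2, T, Ψ, ?_, hΨs.trans hΦB, ?_, ?_, fun u hu => ?_⟩
  · rw [hΨ, OpenPartialHomeomorph.restrOpen_source]
    have : p ∈ Ψ₀.source := hsrc ▸ hpΦ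
    exact ⟨this, this, hqN⟩
  · exact R.symm.contDiff.comp_contDiffOn (hΦ.mono hΨs)
  · refine hΦ'.comp R.contDiff.contDiffOn fun y hy => ?_
    have : y ∈ Ψ₀.target := hy.1
    simpa [hΨ₀] using this
  · have huN : R.symm (Φ u) ∈ N := hu.2.2
    have := hN _ huN
    rw [R.apply_symm_apply, Φ.left_inv (hΨs hu)] at this
    exact this

end Immersed

/-! ### Transfer from charts to the manifold -/

theorem mainTheorem5 {M : Type*} [TopologicalSpace M] [ChartedSpace (RSpace 2) M]
    [IsManifold 𝓘(ℝ, RSpace 2) ∞ M] (x : M → C2)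
    (h_imm : Immersed.IsSmoothImmersion (n := 2) x) (h_lag : Immersed.IsLagrangian x)
    (h_shr : Immersed.IsSelfShrinker (n := 2) x) (h_flat : Immersed.IsFlat (n := 2) x) (p : M) :
    ∃ γ₁ γ₂ : ℝ → ℂ, Immersed.IsAbreschLangerCurve γ₁ ∧ Immersed.IsAbreschLangerCurve γ₂ ∧
      ∃ T : C2 ≃ₗᵢ[ℂ] C2,
        ∃ φ ∈ IsManifold.maximalAtlas 𝓘(ℝ, RSpace 2) ∞ M, p ∈ φ.source ∧
          ∀ q ∈ φ.source, x q = T !₂[γ₁ (φ q 0), γ₂ (φ q 1)] := by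
  set e := chartAt (RSpace 2) p with he
  have hat : e ∈ atlas (RSpace 2) M := chart_mem_atlas _ p
  have hmax : e ∈ IsManifold.maximalAtlas 𝓘(ℝ, RSpace 2) ∞ M := IsManifold.chart_mem_maximalAtlas p
  have hps : p ∈ e.source := mem_chart_source _ p
  obtain ⟨r, hr, hball⟩ := Metric.isOpen_iff.mp e.open_target (e p) (e.map_source hps)
  have hsm : ContDiffOn ℝ ∞ (x ∘ e.symm) e.target :=
    contMDiffOn_iff_contDiffOn.mp
      (h_imm.1.comp_contMDiffOn (contMDiffOn_symm_of_mem_maximalAtlas hmax))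
  -- Chain rule: the chart representative has differential dx ∘ D with D the differential of
  -- `e.symm`, injective because e ∘ `e.symm` is locally the identity. This carries the immersion
  -- and Lagrangian conditions to the chart.
  have hfd : ∀ u ∈ e.target, ∃ D : RSpace 2 →L[ℝ] RSpace 2, Function.Injective D ∧
      ∀ v, fderiv ℝ (x ∘ e.symm) u v
        = (mfderiv 𝓘(ℝ, RSpace 2) 𝓘(ℝ, C2) x (e.symm u) : RSpace 2 →L[ℝ] C2) (D v) := by
    intro u hu
    have hxd : MDifferentiableAt 𝓘(ℝ, RSpace 2) 𝓘(ℝ, C2) x (e.symm u) :=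
      h_imm.1.mdifferentiableAt (by simp)
    have hes : MDifferentiableAt 𝓘(ℝ, RSpace 2) 𝓘(ℝ, RSpace 2) e.symm u :=
      (contMDiffAt_symm_of_mem_maximalAtlas hmax hu).mdifferentiableAt (by simp)
    have hee : MDifferentiableAt 𝓘(ℝ, RSpace 2) 𝓘(ℝ, RSpace 2) e (e.symm u) :=
      (contMDiffAt_of_mem_maximalAtlas hmax (e.map_target hu)).mdifferentiableAt (by simp)
    refine ⟨mfderiv 𝓘(ℝ, RSpace 2) 𝓘(ℝ, RSpace 2) e.symm u, ?_, fun v => ?_⟩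
    · have hcomp := mfderiv_comp u hee hes
      have hid : mfderiv 𝓘(ℝ, RSpace 2) 𝓘(ℝ, RSpace 2) (e ∘ e.symm) u
          = ContinuousLinearMap.id ℝ (RSpace 2) := by
        have : (e ∘ e.symm) =ᶠ[nhds u] id :=
          Filter.eventuallyEq_of_mem (e.open_target.mem_nhds hu) fun w hw => e.right_inv hw
        rw [this.mfderiv_eq, mfderiv_id]
        rfl
      intro v w hvw
      have h1 := congrArg (fun L : RSpace 2 →L[ℝ] RSpace 2 => L v) (hid.symm.trans hcomp)
      have h2 := congrArg (fun L : RSpace 2 →L[ℝ] RSpace 2 => L w) (hid.symm.trans hcomp)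
      refine h1.trans (Eq.trans ?_ h2.symm)
      exact congrArg (mfderiv 𝓘(ℝ, RSpace 2) 𝓘(ℝ, RSpace 2) e (e.symm u)) hvw
    · have := mfderiv_comp u hxd hes
      rw [mfderiv_eq_fderiv] at this
      rw [this]
      rfl
  have hchart : Immersed.IsFlatLagrangianChart (x ∘ e.symm) (Metric.ball (e p) r) := by
    refine ⟨hsm.mono hball, fun u hu => ?_, fun u hu j k => ?_, fun u hu => ?_, fun u hu => ?_⟩
    · obtain ⟨D, hD, hDv⟩ := hfd u (hball hu)
      intro v w hvw
      rw [hDv, hDv] at hvw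
      exact hD (h_imm.2 _ hvw)
    · obtain ⟨D, -, hDv⟩ := hfd u (hball hu)
      rw [Immersed.partialD, Immersed.partialD, hDv, hDv]
      exact h_lag _ _ _
    · exact h_shr e hat u (hball hu)
    · exact h_flat e hat u (hball hu)
  obtain ⟨γ₁, γ₂, h1, h2, T, Ψ, hpΨ, hΨB, hΨ, hΨ', hprod⟩ :=
    hchart.exists_product Metric.isOpen_ball (convex_ball _ _) (Metric.mem_ball_self hr)
  refine ⟨γ₁, γ₂, h1, h2, T, e.trans Ψ, ?_, ?_, fun q hq => ?_⟩
  · refine (e.trans Ψ).mem_maximalAtlas_of_contMDiffOn ?_ ?_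
    · refine (contMDiffOn_iff_contDiffOn.mpr hΨ).comp
        ((contMDiffOn_of_mem_maximalAtlas hmax).mono ?_) ?_
      · exact fun q hq => (by simpa using hq : _ ∧ _).1
      · exact fun q hq => (by simpa using hq : _ ∧ _).2
    · refine (contMDiffOn_symm_of_mem_maximalAtlas hmax).comp
        ((contMDiffOn_iff_contDiffOn.mpr hΨ').mono ?_) ?_
      · exact fun q hq => (by simpa [OpenPartialHomeomorph.trans_target] using hq : _ ∧ _).1
      · exact fun q hq => (by simpa [OpenPartialHomeomorph.trans_target] using hq : _ ∧ _).2
  · simpa using ⟨hps, hpΨ⟩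
  · have hq' : q ∈ e.source ∧ e q ∈ Ψ.source := by simpa using hq
    have := hprod (e q) hq'.2
    rw [Function.comp_apply, e.left_inv hq'.1] at this
    exact this
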